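/- **Setting.** Let $\mathsf G$ be a real split semisimple algebraic Lie group with trivial center and without compact factors (Zariski connected: its identity component is Zariski dense), let $\mathsf V$ be a real vector space with $1<\dim\mathsf V<\infty$, and let $\mathtt R:\mathsf G\to\mathsf{SL}(\mathsf V)$ be a faithful irreducible algebraic representation. We write $gv$ for $\mathtt R(g)v$; the semidirect product $\mathsf G\ltimes_{\mathtt R}\mathsf V$ acts on $\mathsf V$ by $(g,Y)x=gx+Y$. Fix a Cartan involution of $\mathfrak g$ with decomposition $\mathfrak g=\mathfrak k\oplus\mathfrak p$, a maximal abelian subspace $\mathfrak a\subset\mathfrak p$, and an open Weyl chamber $\mathfrak a^{++}$ with closure $\mathfrak a^+$; let $\Sigma^+$ be the set of restricted roots that are positive on $\mathfrak a^{++}$. Let $A=\exp\mathfrak a$, let $W=N_{\mathsf G}(A)/Z_{\mathsf G}(A)$ be the restricted Weyl group, and let $\omega_0\in W$ be its longest element, $\omega_0(\Sigma^+)=-\Sigma^+$. Let $\Omega\subset\mathfrak a^*$ be the set of restricted weights of $\mathtt R$, with weight spaces $\mathsf V^\lambda$; assume $0\in\Omega$. Say that $X,Y\in\mathfrak a$ have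 the same type, $X\sim Y$, if for every $\lambda\in\Omega$ the numbers $\lambda(X)$ and $\lambda(Y)$ have the same sign ($+$, $-$ or $0$). Fix $X_0\in\mathfrak a^+$ that is generic (no nonzero $\lambda\in\Omega$ vanishes at $X_0$), symmetric ($-\omega_0X_0=X_0$) and extreme (for $\omega\in W$, $\omega X_0\sim X_0$ if and only if $\omega X_0=X_0$). Let $\mathsf V^{\pm,0}$ (respectively $\mathsf V^{\pm}$) be the sum of the $\mathsf V^\lambda$ with $\pm\lambda(X_0)\ge 0$ (respectively $>0$), let $\mathsf V^0=\mathsf V^{+,0}\cap\mathsf V^{-,0}$, and let $\pi_0$ be the projection onto $\mathsf V^0$ with respect to $\mathsf V=\mathsf V^+\oplus\mathsf V^0\oplus\mathsf V^-$. The element $\omega_0$ acts on $\mathsf V^0$ through any representative in $N_{\mathsf G}(A)$. A *parabolic space* is a subspace $g\mathsf V^{+,0}$ with $g\in\mathsf G$; two parabolic spaces are *transverse* if their sum is $\mathsf V$. For transverse parabolic spaces choose $h\in\mathsf G$ with $(\mathsf V_i,\mathsf V_j)=h(\mathsf V^{+,0},\mathsf V^{-,0})$ and put $\nu^*(\mathsf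 V_i,\mathsf V_j)=\pi_0h^{-1}$. An *affine parabolic space* is an affine subspace $\mathsf A_i$ of $\mathsf V$ parallel to a parabolic space $\mathsf V_i$; two of them are transverse if their directions are, and then $\nu^*_{i,j}:=\nu^*(\mathsf V_i,\mathsf V_j)$. For mutually transverse affine parabolic spaces put $$\beta_{i,j,k,l}=\beta(\mathsf A_i,\mathsf A_j,\mathsf A_k,\mathsf A_l)=[\nu^*_{i,l}-\nu^*_{j,k}](X_{i,k}-X_{j,l}),\qquad X_{i,k}\in\mathsf A_i\cap\mathsf A_k,\ X_{j,l}\in\mathsf A_j\cap\mathsf A_l,$$ (the *affine cross ratio*) and, for $X_i\in\mathsf A_i$, $$\delta_{2,3,4}=[\nu^*_{2,3}+\nu^*_{3,2}](X_2-X_3)+[\nu^*_{3,4}+\nu^*_{4,3}](X_3-X_4)+[\nu^*_{4,2}+\nu^*_{2,4}](X_4-X_2)$$ (the *affine triple ratio*). **Proposition.** Let $\mathsf A_*,\mathsf A_1,\mathsf A_2,\mathsf A_3,\mathsf A_4$ be mutually transverse affine parabolic spaces. Then $\pi_0$, the maps $\nu^*$, and $\beta$ and $\delta$ are well defined (the choices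 above exist, and the results do not depend on them), and for every $(g,Y)\in\mathsf G\ltimes_{\mathtt R}\mathsf V$: 1. $\beta((g,Y)\mathsf A_1,(g,Y)\mathsf A_2,(g,Y)\mathsf A_3,(g,Y)\mathsf A_4)=\beta(\mathsf A_1,\mathsf A_2,\mathsf A_3,\mathsf A_4)$; 2. $\beta_{1,2,3,4}=\beta_{2,1,4,3}=-\omega_0\beta_{3,4,1,2}=-\omega_0\beta_{4,3,2,1}$; 3. $\beta_{1,2,3,4}+\beta_{1,2,4,3}=0$; 4. $\beta_{1,*,3,4}+\beta_{*,2,3,4}=\beta_{1,2,3,4}$; 5. $\delta_{2,3,4}=\beta_{*,2,3,4}+\beta_{*,3,4,2}+\beta_{*,4,2,3}$. -/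

import Mathlib

noncomputable section

namespace AffineInv

attribute [local instance] LieRing.ofAssociativeRing

variable {G V : Type*} [Group G] [NormedAddCommGroup V] [NormedSpace ℝ V]

/-! ### The linear Lie group `R(G)`

A faithful algebraic representation `R : G → SL(V)` identifies the Lie group `G` with the linear
Lie group `R(G) ⊆ SL(V)`, its Lie algebra with `d_eR(𝔤) ⊆ 𝔰𝔩(V)`, `exp` with the exponential of
endomorphisms and `Ad_g` with conjugation by `R g`.  All notions below are read off `R(G)`. -/

/-- `𝔤` is the Lie algebra of the linear group `R(G)`: it consists of the generators of the
one-parameter subgroups contained in `R(G)`. -/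
def IsLieAlgebraOf (R : G →* (V →L[ℝ] V)) (𝔤 : LieSubalgebra ℝ (V →L[ℝ] V)) : Prop :=
  ∀ X : V →L[ℝ] V, X ∈ 𝔤 ↔ ∀ t : ℝ, NormedSpace.exp (t • X) ∈ Set.range R

/-- The identity component of `G`, i.e. the subgroup generated by `exp 𝔤`. -/
def identityComponent (R : G →* (V →L[ℝ] V)) (𝔤 : LieSubalgebra ℝ (V →L[ℝ] V)) : Subgroup G :=
  Subgroup.closure {g | ∃ X ∈ 𝔤, R g = NormedSpace.exp X}

/-- The algebra of polynomial functions on `End(V)`: it is generated by the linear forms. -/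
def polynomialFunctions (V : Type*) [NormedAddCommGroup V] [NormedSpace ℝ V] :
    Subalgebra ℝ ((V →L[ℝ] V) → ℝ) :=
  Algebra.adjoin ℝ (Set.range fun φ : Module.Dual ℝ (V →L[ℝ] V) => (φ : (V →L[ℝ] V) → ℝ))

/-- The identity component is Zariski dense in `R(G)`.  This holds if `G` is connected as a Lie
group, and also if `R(G)` is the group of real points of a Zariski connected algebraic group. -/
def IsZariskiConnected (R : G →* (V →L[ℝ] V)) (𝔤 : LieSubalgebra ℝ (V →L[ℝ] V)) : Prop :=
  ∀ f ∈ polynomialFunctions V,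
    (∀ g ∈ identityComponent R 𝔤, f (R g) = 0) → ∀ g : G, f (R g) = 0

/-- `Ad_g X`, where `X` is an endomorphism of `V`. -/
def Ad (R : G →* (V →L[ℝ] V)) (g : G) (X : V →L[ℝ] V) : V →L[ℝ] V := R g * X * R g⁻¹

/-- `θ` is a Cartan involution of `𝔤`: an involutive automorphism for which the form
`(X, Y) ↦ -B(X, θ Y)` is positive definite, where `B` is the Killing form. -/
def IsCartanInvolution {𝔤 : LieSubalgebra ℝ (V →L[ℝ] V)} (θ : 𝔤 ≃ₗ⁅ℝ⁆ 𝔤) : Prop :=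
  (∀ X, θ (θ X) = X) ∧ ∀ X, X ≠ 0 → killingForm ℝ 𝔤 X (θ X) < 0

/-- `𝔭`, the eigenspace of `θ` for the eigenvalue `-1`, as a set of endomorphisms of `V`. -/
def cartanP {𝔤 : LieSubalgebra ℝ (V →L[ℝ] V)} (θ : 𝔤 ≃ₗ⁅ℝ⁆ 𝔤) : Set (V →L[ℝ] V) :=
  {X | ∃ h : X ∈ 𝔤, θ ⟨X, h⟩ = -⟨X, h⟩}

/-- `𝔞` is a maximal abelian subspace of `𝔭`. -/
def IsMaximalAbelian {𝔤 : LieSubalgebra ℝ (V →L[ℝ] V)} (θ : 𝔤 ≃ₗ⁅ℝ⁆ 𝔤)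
    (𝔞 : Submodule ℝ (V →L[ℝ] V)) : Prop :=
  (∀ H ∈ 𝔞, H ∈ cartanP θ) ∧ (∀ H ∈ 𝔞, ∀ H' ∈ 𝔞, ⁅H, H'⁆ = 0) ∧
    ∀ X ∈ cartanP θ, (∀ H ∈ 𝔞, ⁅H, X⁆ = 0) → X ∈ 𝔞

/-- `𝔤` is split: the centralizer `𝔤⁰` of `𝔞` in `𝔤` is `𝔞` itself. -/
def IsSplit (𝔤 : LieSubalgebra ℝ (V →L[ℝ] V)) (𝔞 : Submodule ℝ (V →L[ℝ] V)) : Prop :=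
  ∀ X ∈ 𝔤, (∀ H ∈ 𝔞, ⁅H, X⁆ = 0) → X ∈ 𝔞

/-! ### Restricted roots, Weyl chambers, restricted weights, the restricted Weyl group -/

/-- The restricted root space `𝔤^α`. -/
def rootSpace (𝔤 : LieSubalgebra ℝ (V →L[ℝ] V)) (𝔞 : Submodule ℝ (V →L[ℝ] V))
    (α : Module.Dual ℝ 𝔞) : Set (V →L[ℝ] V) :=
  {X | X ∈ 𝔤 ∧ ∀ H : 𝔞, ⁅(H : V →L[ℝ] V), X⁆ = α H • X}

/-- The set `Σ` of restricted roots. -/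
def roots (𝔤 : LieSubalgebra ℝ (V →L[ℝ] V)) (𝔞 : Submodule ℝ (V →L[ℝ] V)) :
    Set (Module.Dual ℝ 𝔞) :=
  {α | α ≠ 0 ∧ ∃ X ∈ rootSpace 𝔤 𝔞 α, X ≠ 0}

/-- The complement in `𝔞` of the kernels of the restricted roots. -/
def regularSet (𝔤 : LieSubalgebra ℝ (V →L[ℝ] V)) (𝔞 : Submodule ℝ (V →L[ℝ] V)) : Set 𝔞 :=
  {H | ∀ α ∈ roots 𝔤 𝔞, α H ≠ 0}

/-- `C` is a connected component of the complement of the kernels of the roots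
(an open Weyl chamber `𝔞⁺⁺`). -/
def IsOpenChamber (𝔤 : LieSubalgebra ℝ (V →L[ℝ] V)) (𝔞 : Submodule ℝ (V →L[ℝ] V))
    (C : Set 𝔞) : Prop :=
  ∃ H ∈ regularSet 𝔤 𝔞, C = connectedComponentIn (regularSet 𝔤 𝔞) H

/-- The set `Σ⁺` of the restricted roots that are positive on the open chamber `C`. -/
def positiveRoots (𝔤 : LieSubalgebra ℝ (V →L[ℝ] V)) (𝔞 : Submodule ℝ (V →L[ℝ] V))
    (C : Set 𝔞) : Set (Module.Dual ℝ 𝔞) :=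
  {α | α ∈ roots 𝔤 𝔞 ∧ ∀ H ∈ C, 0 < α H}

/-- The restricted weight space `V^μ` (`𝔞` acts on `V` through `d_eR`, here the inclusion). -/
def weightSpace (𝔞 : Submodule ℝ (V →L[ℝ] V)) (μ : Module.Dual ℝ 𝔞) : Submodule ℝ V where
  carrier := {v | ∀ H : 𝔞, (H : V →L[ℝ] V) v = μ H • v}
  add_mem' := by
    intro v w hv hw H
    rw [map_add, hv H, hw H, smul_add]
  zero_mem' := by
    intro H
    rw [map_zero, smul_zero]
  smul_mem' := by
    intro c v hv H
    rw [map_smul, hv H, smul_comm]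

/-- The set `Ω` of restricted weights. -/
def weights (𝔞 : Submodule ℝ (V →L[ℝ] V)) : Set (Module.Dual ℝ 𝔞) :=
  {μ | weightSpace 𝔞 μ ≠ ⊥}

/-- `Ω⁺(X)`. -/
def weightsPos (𝔞 : Submodule ℝ (V →L[ℝ] V)) (X : 𝔞) : Set (Module.Dual ℝ 𝔞) :=
  {μ | μ ∈ weights 𝔞 ∧ 0 < μ X}

/-- `Ω⁻(X)`. -/
def weightsNeg (𝔞 : Submodule ℝ (V →L[ℝ] V)) (X : 𝔞) : Set (Module.Dual ℝ 𝔞) :=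
  {μ | μ ∈ weights 𝔞 ∧ μ X < 0}

/-- `Ω^{+,0}(X)`. -/
def weightsNonneg (𝔞 : Submodule ℝ (V →L[ℝ] V)) (X : 𝔞) : Set (Module.Dual ℝ 𝔞) :=
  {μ | μ ∈ weights 𝔞 ∧ 0 ≤ μ X}

/-- `Ω^{-,0}(X)`. -/
def weightsNonpos (𝔞 : Submodule ℝ (V →L[ℝ] V)) (X : 𝔞) : Set (Module.Dual ℝ 𝔞) :=
  {μ | μ ∈ weights 𝔞 ∧ μ X ≤ 0}

/-- `X` and `Y` are of the same type. -/
def SameType (𝔞 : Submodule ℝ (V →L[ℝ] V)) (X Y : 𝔞) : Prop :=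
  weightsPos 𝔞 X = weightsPos 𝔞 Y ∧ weightsNeg 𝔞 X = weightsNeg 𝔞 Y

/-- The subgroup `A = exp 𝔞` of `G`, as a set. -/
def cartanA (R : G →* (V →L[ℝ] V)) (𝔞 : Submodule ℝ (V →L[ℝ] V)) : Set G :=
  {g | ∃ H ∈ 𝔞, R g = NormedSpace.exp H}

/-- `n` represents an element of the restricted Weyl group `W = N_G(A) / Z_G(A)`,
i.e. `n A n⁻¹ = A`.  The class of `n` acts on `𝔞` by `Ad_n`, and on `V⁰` by `R n`. -/
def IsWeylRep (R : G →* (V →L[ℝ] V)) (𝔞 : Submodule ℝ (V →L[ℝ] V)) (n : G) : Prop :=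
  (fun x => n * x * n⁻¹) '' cartanA R 𝔞 = cartanA R 𝔞

/-- `Y = ω X` in `𝔞`, where `ω ∈ W` is the class of `n`. -/
def WeylMaps (R : G →* (V →L[ℝ] V)) (𝔞 : Submodule ℝ (V →L[ℝ] V)) (n : G) (X Y : 𝔞) : Prop :=
  (Y : V →L[ℝ] V) = Ad R n X

/-- `β = ω α` in `𝔞*`, where `ω ∈ W` is the class of `n`, i.e. `β(ω X) = α(X)`. -/
def WeylMapsDual (R : G →* (V →L[ℝ] V)) (𝔞 : Submodule ℝ (V →L[ℝ] V)) (n : G)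
    (α β : Module.Dual ℝ 𝔞) : Prop :=
  ∀ X Y : 𝔞, WeylMaps R 𝔞 n X Y → β Y = α X

/-- `n` represents the longest element `ω₀` of the restricted Weyl group: `ω₀(Σ⁺) = -Σ⁺`. -/
def IsLongestRep (R : G →* (V →L[ℝ] V)) (𝔤 : LieSubalgebra ℝ (V →L[ℝ] V))
    (𝔞 : Submodule ℝ (V →L[ℝ] V)) (C : Set 𝔞) (n : G) : Prop :=
  IsWeylRep R 𝔞 n ∧
    {β | ∃ α ∈ positiveRoots 𝔤 𝔞 C, WeylMapsDual R 𝔞 n α β} = {β | -β ∈ positiveRoots 𝔤 𝔞 C}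

/-- `X` is generic: `Ω⁰(X) ⊆ {0}`. -/
def IsGeneric (𝔞 : Submodule ℝ (V →L[ℝ] V)) (X : 𝔞) : Prop :=
  weightsNonneg 𝔞 X ∩ weightsNonpos 𝔞 X ⊆ {0}

/-- `X` is extreme: the Weyl group elements `ω` with `ω X ∼ X` are those with `ω X = X`. -/
def IsExtreme (R : G →* (V →L[ℝ] V)) (𝔞 : Submodule ℝ (V →L[ℝ] V)) (X : 𝔞) : Prop :=
  ∀ n : G, IsWeylRep R 𝔞 n → ∀ Y : 𝔞, WeylMaps R 𝔞 n X Y → (SameType 𝔞 Y X ↔ Y = X)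

/-! ### The standing data -/

/-- A faithful irreducible algebraic representation `R : G → SL(V)` of a real split semisimple
algebraic Lie group `G` with trivial center, together with a Cartan involution `θ`, a Cartan
subspace `𝔞`, an open Weyl chamber, a representative `w₀ ∈ G` of the longest element of the
restricted Weyl group, and an extreme, symmetric and generic vector `X₀` in the closed Weyl
chamber.  Zero is a weight of `R`. -/
structure NonSwingingRep (G V : Type*) [Group G] [NormedAddCommGroup V] [NormedSpace ℝ V] where
  /-- the representation -/
  R : G →* (V →L[ℝ] V)
  det_eq_one : ∀ g, (R g).det = 1
  faithful : Function.Injective R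
  irreducible : ∀ U : Submodule ℝ V, (∀ g, ∀ v ∈ U, R g v ∈ U) → U = ⊥ ∨ U = ⊤
  isClosed_range : IsClosed (Set.range R)
  center_trivial : Subgroup.center G = ⊥
  /-- the Lie algebra of `G` -/
  𝔤 : LieSubalgebra ℝ (V →L[ℝ] V)
  isLieAlgebra : IsLieAlgebraOf R 𝔤
  zariskiConnected : IsZariskiConnected R 𝔤
  semisimple : LieAlgebra.IsSemisimple ℝ 𝔤
  /-- the Cartan involution -/
  θ : 𝔤 ≃ₗ⁅ℝ⁆ 𝔤
  isCartanInvolution : IsCartanInvolution θ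
  /-- the Cartan subspace -/
  𝔞 : Submodule ℝ (V →L[ℝ] V)
  isMaximalAbelian : IsMaximalAbelian θ 𝔞
  split : IsSplit 𝔤 𝔞
  /-- the open Weyl chamber `𝔞⁺⁺` -/
  chamber : Set 𝔞
  isOpenChamber : IsOpenChamber 𝔤 𝔞 chamber
  /-- a representative of the longest element of the restricted Weyl group -/
  w₀ : G
  longest : IsLongestRep R 𝔤 𝔞 chamber w₀
  zero_mem_weights : (0 : Module.Dual ℝ 𝔞) ∈ weights 𝔞
  /-- the chosen extreme, symmetric and generic vector -/
  X₀ : 𝔞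
  mem_chamber : X₀ ∈ closure chamber
  generic : IsGeneric 𝔞 X₀
  symmetric : WeylMaps R 𝔞 w₀ X₀ (-X₀)
  extreme : IsExtreme R 𝔞 X₀

namespace NonSwingingRep

variable (S : NonSwingingRep G V)

/-- `V⁺`. -/
def Vpos : Submodule ℝ V := ⨆ μ ∈ weightsPos S.𝔞 S.X₀, weightSpace S.𝔞 μ

/-- `V⁻`. -/
def Vneg : Submodule ℝ V := ⨆ μ ∈ weightsNeg S.𝔞 S.X₀, weightSpace S.𝔞 μ

/-- `V^{+,0}`. -/
def Vpos0 : Submodule ℝ V := ⨆ μ ∈ weightsNonneg S.𝔞 S.X₀, weightSpace S.𝔞 μ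

/-- `V^{-,0}`. -/
def Vneg0 : Submodule ℝ V := ⨆ μ ∈ weightsNonpos S.𝔞 S.X₀, weightSpace S.𝔞 μ

/-- `V⁰ = V^{+,0} ∩ V^{-,0}`. -/
def Vzero : Submodule ℝ V := S.Vpos0 ⊓ S.Vneg0

open Classical in
/-- The projection `π₀` onto `V⁰` with respect to `V = V⁺ ⊕ V⁰ ⊕ V⁻`. -/
def proj0 : V →ₗ[ℝ] V :=
  if h : IsCompl S.Vzero (S.Vpos ⊔ S.Vneg) then
    S.Vzero.subtype ∘ₗ Submodule.projectionOnto S.Vzero (S.Vpos ⊔ S.Vneg) h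
  else 0

/-- The image `g W` of a subspace. -/
def translate (g : G) (W : Submodule ℝ V) : Submodule ℝ V := W.map (S.R g : V →ₗ[ℝ] V)

/-- `W` is a parabolic space: `W = g V^{+,0}` for some `g ∈ G`. -/
def IsParabolic (W : Submodule ℝ V) : Prop := ∃ g : G, W = S.translate g S.Vpos0

/-- `h` satisfies `(W₁, W₂) = h (V^{+,0}, V^{-,0})`. -/
def IsFrame (h : G) (W₁ W₂ : Submodule ℝ V) : Prop :=
  W₁ = S.translate h S.Vpos0 ∧ W₂ = S.translate h S.Vneg0

open Classical in
/-- The co-neutral map: `ν*(W₁, W₂) = π₀ h⁻¹` for any `h` with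
`(W₁, W₂) = h (V^{+,0}, V^{-,0})`. -/
def coNeutral (W₁ W₂ : Submodule ℝ V) : V →ₗ[ℝ] V :=
  if H : ∃ h : G, S.IsFrame h W₁ W₂ then
    S.proj0 ∘ₗ (S.R H.choose⁻¹ : V →ₗ[ℝ] V)
  else 0

/-- `ν*(A₁, A₂) := ν*(W₁, W₂)`, where `W₁`, `W₂` are the directions of `A₁`, `A₂`. -/
def nuStar (A₁ A₂ : AffineSubspace ℝ V) : V →ₗ[ℝ] V := S.coNeutral A₁.direction A₂.direction

/-- Affine parabolic spaces: the affine subspaces parallel to parabolic spaces. -/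
def IsAffineParabolic (A : AffineSubspace ℝ V) : Prop :=
  (A : Set V).Nonempty ∧ S.IsParabolic A.direction

/-- The affine action of `(g, Y) ∈ G ⋉_R V` on `V`, `x ↦ R(g) x + Y`. -/
def act (g : G) (Y : V) : V →ᵃ[ℝ] V :=
  (S.R g : V →ₗ[ℝ] V).toAffineMap + AffineMap.const ℝ V Y

/-- `b` is the value `(ν*_{1,4} - ν*_{2,3})(X_{1,3} - X_{2,4})` for some choice of points
`X_{1,3} ∈ A₁ ∩ A₃` and `X_{2,4} ∈ A₂ ∩ A₄`. -/
def IsCrossRatioValue (A₁ A₂ A₃ A₄ : AffineSubspace ℝ V) (b : V) : Prop :=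
  ∃ X13 X24 : V, X13 ∈ A₁ ∧ X13 ∈ A₃ ∧ X24 ∈ A₂ ∧ X24 ∈ A₄ ∧
    b = (S.nuStar A₁ A₄ - S.nuStar A₂ A₃) (X13 - X24)

open Classical in
/-- The affine cross ratio `β(A₁, A₂, A₃, A₄)`. -/
def crossRatio (A₁ A₂ A₃ A₄ : AffineSubspace ℝ V) : V :=
  if H : ∃ b, S.IsCrossRatioValue A₁ A₂ A₃ A₄ b then H.choose else 0

/-- `d` is the value of the triple ratio formula for some choice of points `X_i ∈ A_i`. -/
def IsTripleRatioValue (A₂ A₃ A₄ : AffineSubspace ℝ V) (d : V) : Prop :=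
  ∃ X2 X3 X4 : V, X2 ∈ A₂ ∧ X3 ∈ A₃ ∧ X4 ∈ A₄ ∧
    d = (S.nuStar A₂ A₃ + S.nuStar A₃ A₂) (X2 - X3)
      + (S.nuStar A₃ A₄ + S.nuStar A₄ A₃) (X3 - X4)
      + (S.nuStar A₄ A₂ + S.nuStar A₂ A₄) (X4 - X2)

open Classical in
/-- The affine triple ratio `δ(A₂, A₃, A₄)`. -/
def tripleRatio (A₂ A₃ A₄ : AffineSubspace ℝ V) : V :=
  if H : ∃ d, S.IsTripleRatioValue A₂ A₃ A₄ d then H.choose else 0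

/-- All choices in the definitions of `π₀`, `ν*`, `β` and `δ` can be made, and the results do not
depend on them. -/
def ChoicesWellDefined (A : Fin 5 → AffineSubspace ℝ V) : Prop :=
  IsCompl S.Vzero (S.Vpos ⊔ S.Vneg) ∧
  (∀ i j, i ≠ j → ∃ h : G, S.IsFrame h (A i).direction (A j).direction) ∧
  (∀ i j, i ≠ j → ∀ h : G, S.IsFrame h (A i).direction (A j).direction →
    S.nuStar (A i) (A j) = S.proj0 ∘ₗ (S.R h⁻¹ : V →ₗ[ℝ] V)) ∧
  (∃! b, S.IsCrossRatioValue (A 1) (A 2) (A 3) (A 4) b) ∧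
  (∃! d, S.IsTripleRatioValue (A 2) (A 3) (A 4) d)

end NonSwingingRep

end AffineInv

end

set_option linter.unusedSectionVars false

noncomputable section

namespace AffineInv

/-! ### Independent families of subspaces indexed by sets -/

section GradedSum

variable {D M : Type*} [AddCommGroup M] [Module ℝ M] {E : D → Submodule ℝ M}

/-! The identities are formal consequences of two properties of the co-neutral maps. On the
direction of `A i`, neither ν*_{i,j} nor ν*_{j,i} depends on j (`coNeutral_left`,
`coNeutral_right`), and ω₀ν*_{j,i} = ν*_{i,j} (`coNeutral_swap`). A point can therefore be moved
inside `A i` while the other index is exchanged; what remains is linear algebra. The content lies in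
two facts about the stabilizer P of V^{+,0}: transverse pairs have frames, and P acts trivially on
V^{+,0}/V⁺.

Frames come from a Bruhat decomposition g = u w v (`exists_bruhat`), with u, v unipotent and w
normalizing 𝔞. For the Killing form the Borel subalgebra 𝔟 is the orthogonal of its nilradical 𝔫,
and the isotropic vectors of 𝔟 lie in 𝔫. Hence 𝔟 ∩ Ad_g 𝔟 surjects onto 𝔟/𝔫, and the two Borel
subalgebras share an element that is regular in both. Unipotent conjugations carry it into 𝔞
(`exists_conj`), which turns g into some w. Since u and v fix V^{+,0} and V⁺, questions about g
V^{+,0} become questions about sets of weights: transversality forces w V^{+,0} = V^{-,0}, and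
elements of P preserve V⁺.

For the trivial action, splitness and genericity show that the Lie algebra has zero V⁰-block
(`proj0_lie_apply`). As P may be disconnected, this cannot simply be integrated over P. Instead,
consider the neutral part of the Schur complement of the V⁺-block of g, written as a quotient of two
polynomials in g (a bordered minor over a minor). Along an analytic path from 1 in the identity
component its derivative vanishes near the start (`hasDerivAt_quotient`); analyticity and Zariski
density then give a polynomial identity on all of G (`det_borderedMatrix_eq`). For p ∈ P the
V⁺-block is invertible and the Schur complement is π₀ p on V⁰, so π₀ p is the identity there
(`proj0_R_of_mem_Vzero`). -/

/-- The sum of the members of a family of subspaces with index in `s`. -/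
def gradedSum (E : D → Submodule ℝ M) (s : Set D) : Submodule ℝ M := ⨆ μ ∈ s, E μ

lemma le_gradedSum {s : Set D} {μ : D} (h : μ ∈ s) : E μ ≤ gradedSum E s :=
  le_iSup₂_of_le μ h le_rfl

lemma gradedSum_le {s : Set D} {W : Submodule ℝ M} (h : ∀ μ ∈ s, E μ ≤ W) : gradedSum E s ≤ W :=
  iSup₂_le h

lemma gradedSum_mono {s t : Set D} (h : s ⊆ t) : gradedSum E s ≤ gradedSum E t :=
  gradedSum_le fun _ hμ => le_gradedSum (h hμ)

lemma gradedSum_union (s t : Set D) : gradedSum E (s ∪ t) = gradedSum E s ⊔ gradedSum E t :=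
  iSup_union

lemma gradedSum_univ : gradedSum E Set.univ = ⨆ μ, E μ := by simp [gradedSum]

lemma gradedSum_singleton (μ : D) : gradedSum E {μ} = E μ := by simp [gradedSum]

/-- Families here are indexed by all linear forms, of which only the roots or weights contribute;
this allows conditions to be checked on those alone. -/
lemma gradedSum_mono_of_ne_bot {s t : Set D} (h : ∀ μ ∈ s, E μ ≠ ⊥ → μ ∈ t) :
    gradedSum E s ≤ gradedSum E t :=
  gradedSum_le fun μ hμ => by
    by_cases h0 : E μ = ⊥
    · simp [h0]
    · exact le_gradedSum (h μ hμ h0)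

lemma gradedSum_disjoint (hE : iSupIndep E) {s t : Set D} (h : Disjoint s t) :
    Disjoint (gradedSum E s) (gradedSum E t) :=
  hE.disjoint_biSup_biSup h

/-- Split `s` into `s ∩ t` and `s \ t` and apply the modular law; independence kills the second
part. -/
lemma gradedSum_inf (hE : iSupIndep E) (s t : Set D) :
    gradedSum E s ⊓ gradedSum E t = gradedSum E (s ∩ t) := by
  apply le_antisymm
  · have hs : gradedSum E s = gradedSum E (s ∩ t) ⊔ gradedSum E (s \ t) := by
      rw [← gradedSum_union, Set.inter_union_sdiff]
    rw [hs, sup_inf_assoc_of_le _ (gradedSum_mono Set.inter_subset_right),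
      (gradedSum_disjoint hE Set.disjoint_sdiff_left).eq_bot, sup_bot_eq]
  · exact le_inf (gradedSum_mono Set.inter_subset_left) (gradedSum_mono Set.inter_subset_right)

lemma gradedSum_induction {s : Set D} {p : M → Prop} (h0 : p 0)
    (hadd : ∀ x y, p x → p y → p (x + y)) (h : ∀ μ ∈ s, ∀ x ∈ E μ, p x) {x : M}
    (hx : x ∈ gradedSum E s) : p x := by
  have hle : x ∈ ⨆ μ : s, E μ := by rwa [gradedSum, ← iSup_subtype''] at hx
  exact Submodule.iSup_induction (motive := p) _ hle (fun μ x hx => h μ μ.2 x hx) h0 hadd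

lemma gradedSum_map {N : Type*} [AddCommGroup N] [Module ℝ N] (f : M →ₗ[ℝ] N) (s : Set D) :
    (gradedSum E s).map f = gradedSum (fun μ => (E μ).map f) s := by
  simp [gradedSum, Submodule.map_iSup]

end GradedSum

/-! ### Joint eigenspaces -/

section JointEigenspace

variable {ι M : Type*} [AddCommGroup M] [Module ℝ M]

/-- Joint eigenspaces of commuting endomorphisms are independent. -/
lemma iSupIndep_jointEigenspace (f : ι → Module.End ℝ M) (h : ∀ i j, Commute (f i) (f j)) :
    iSupIndep fun χ : ι → ℝ => ⨅ i, (f i).eigenspace (χ i) :=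
  (Module.End.independent_iInf_maxGenEigenspace_of_forall_mapsTo f fun i j φ =>
    Module.End.mapsTo_maxGenEigenspace_of_comm (h j i) φ).mono fun χ =>
      iInf_mono fun i => Module.End.genEigenspace_le_maximal (f i) (χ i) 1

/-- Commuting endomorphisms that are symmetric for a positive definite form are jointly
diagonalizable. -/
lemma iSup_jointEigenspace_of_symmetric [FiniteDimensional ℝ M] (b : LinearMap.BilinForm ℝ M)
    (hsymm : ∀ x y, b x y = b y x) (hpos : ∀ x, x ≠ 0 → 0 < b x x) (f : ι → Module.End ℝ M)
    (hf : ∀ i x y, b (f i x) y = b x (f i y)) (h : ∀ i j, Commute (f i) (f j)) :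
    ⨆ χ : ι → ℝ, ⨅ i, (f i).eigenspace (χ i) = ⊤ := by
  -- The form `b` becomes the inner product, so that the spectral theorem for commuting symmetric
  -- operators applies.
  let c : InnerProductSpace.Core ℝ M :=
    { inner := fun x y => b x y
      conj_inner_symm := fun x y => by simpa using hsymm y x
      re_inner_nonneg := fun x => by
        rcases eq_or_ne x 0 with rfl | hx
        · simp
        · simpa using (hpos x hx).le
      add_left := fun x y z => by simp
      smul_left := fun x y r => by simp
      definite := fun x hx => by
        by_contra h0
        exact (hpos x h0).ne' hx }
  let _ : NormedAddCommGroup M := c.toNormedAddCommGroup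
  let _ : InnerProductSpace ℝ M := InnerProductSpace.ofCore c.toCore
  exact LinearMap.IsSymmetric.iSup_iInf_eq_top_of_commute (T := f) (fun i x y => hf i x y)
    fun i j _ => h i j

end JointEigenspace

/-! ### Isotropic subspaces -/

lemma orthogonal_sup {M : Type*} [AddCommGroup M] [Module ℝ M] (B : LinearMap.BilinForm ℝ M)
    (W₁ W₂ : Submodule ℝ M) : B.orthogonal (W₁ ⊔ W₂) = B.orthogonal W₁ ⊓ B.orthogonal W₂ := by
  apply le_antisymm
  · exact le_inf (LinearMap.BilinForm.orthogonal_le le_sup_left)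
      (LinearMap.BilinForm.orthogonal_le le_sup_right)
  · rintro x ⟨h₁, h₂⟩ y hy
    obtain ⟨y₁, hy₁, y₂, hy₂, rfl⟩ := Submodule.mem_sup.1 hy
    have e₁ : B y₁ x = 0 := h₁ y₁ hy₁
    have e₂ : B y₂ x = 0 := h₂ y₂ hy₂
    change B (y₁ + y₂) x = 0
    rw [map_add, LinearMap.add_apply, e₁, e₂, add_zero]

/-- If `n` is the nilradical of `b = n^⊥` in the sense that every isotropic vector of `b` is in
`n`, then for an isometry `φ` the intersection `b ∩ φ b` surjects onto `b / n`. -/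
lemma inf_map_sup_eq_of_isotropic {M : Type*} [AddCommGroup M] [Module ℝ M] [FiniteDimensional ℝ M]
    (B : LinearMap.BilinForm ℝ M) (hB : B.Nondegenerate) (hsymm : ∀ x y, B x y = B y x)
    {n b : Submodule ℝ M} (hnb : B.orthogonal n = b) (hle : n ≤ b)
    (hiso : ∀ x ∈ b, B x x = 0 → x ∈ n) (φ : M ≃ₗ[ℝ] M) (hφ : ∀ x y, B (φ x) (φ y) = B x y) :
    (b ⊓ b.map (φ : M →ₗ[ℝ] M)) ⊔ n = b := by
  have hrefl : B.IsRefl := fun x y h => by rw [hsymm, h]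
  have hbn : B.orthogonal b = n := by
    rw [← hnb, LinearMap.BilinForm.orthogonal_orthogonal hB hrefl]
  have hφn : B.orthogonal (n.map (φ : M →ₗ[ℝ] M)) = b.map (φ : M →ₗ[ℝ] M) := by
    ext x
    rw [LinearMap.BilinForm.mem_orthogonal_iff, ← hnb]
    constructor
    · intro h
      refine ⟨φ.symm x, ?_, by simp⟩
      rw [SetLike.mem_coe, LinearMap.BilinForm.mem_orthogonal_iff]
      intro y hy
      have := h (φ y) ⟨y, hy, rfl⟩
      rw [← hφ, φ.apply_symm_apply, this]
    · rintro ⟨y, hy, rfl⟩ z ⟨w, hw, rfl⟩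
      exact (hφ w y).trans (hy w hw)
  have hinf : b ⊓ b.map (φ : M →ₗ[ℝ] M) = B.orthogonal (n ⊔ n.map (φ : M →ₗ[ℝ] M)) := by
    rw [orthogonal_sup, hnb, hφn]
  apply le_antisymm (sup_le inf_le_left hle)
  -- Passing to orthogonals reverses the wanted inclusion. An element `y + φ w` of the orthogonal
  -- has `φ w` in `b`, and `φ w` is isotropic because `w` is, so it lies in `n`.
  have hkey : B.orthogonal ((b ⊓ b.map (φ : M →ₗ[ℝ] M)) ⊔ n) ≤ n := by
    rw [orthogonal_sup, hinf,
      LinearMap.BilinForm.orthogonal_orthogonal hB hrefl, hnb]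
    rintro x ⟨hx, hxb⟩
    obtain ⟨y, hy, z, ⟨w, hw, rfl⟩, rfl⟩ := Submodule.mem_sup.1 hx
    have hwn : φ w ∈ b := (Submodule.add_mem_iff_right b (hle hy)).1 hxb
    have h0 : B w w = 0 := by
      have := hle hw
      rw [← hnb] at this
      exact this w hw
    exact add_mem hy (hiso _ hwn ((hφ w w).trans h0))
  have := LinearMap.BilinForm.orthogonal_le (B := B) hkey
  rwa [LinearMap.BilinForm.orthogonal_orthogonal hB hrefl, hnb] at this

/-! ### Exponentials of endomorphisms -/

section Exp

open NormedSpace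

variable {E : Type*} [NormedAddCommGroup E] [NormedSpace ℝ E]

lemma hasSum_exp_apply [CompleteSpace E] (T : E →L[ℝ] E) (z : E) :
    HasSum (fun n : ℕ => (n.factorial⁻¹ : ℝ) • (T ^ n) z) (exp T z) := by
  have := (exp_series_hasSum_exp' (𝕂 := ℝ) T).mapL (ContinuousLinearMap.apply ℝ E z)
  simpa using this

lemma pow_apply_mem {T : E →L[ℝ] E} {W : Submodule ℝ E} (hT : ∀ w ∈ W, T w ∈ W) (n : ℕ) {z : E}
    (hz : z ∈ W) : (T ^ n) z ∈ W := by
  induction n with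
  | zero => simpa
  | succ n ih => rw [pow_succ', mul_apply_eq_comp]; exact hT _ ih

lemma mem_of_hasSum [FiniteDimensional ℝ E] {W : Submodule ℝ E} {f : ℕ → E} {z : E}
    (h : HasSum f z) (hf : ∀ n, f n ∈ W) : z ∈ W :=
  (Submodule.closed_of_finiteDimensional W).mem_of_tendsto h
    (Filter.Eventually.of_forall fun _ => W.sum_mem fun n _ => hf n)

lemma exp_apply_mem [CompleteSpace E] [FiniteDimensional ℝ E] {T : E →L[ℝ] E} {W : Submodule ℝ E}
    (hT : ∀ w ∈ W, T w ∈ W) {z : E} (hz : z ∈ W) : exp T z ∈ W :=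
  mem_of_hasSum (hasSum_exp_apply T z) fun n => W.smul_mem _ (pow_apply_mem hT n hz)

/-- Every term of the exponential series from degree two on lies in `W`, which is closed; this is
the first-order expansion used for conjugation by unipotents. -/
lemma exp_apply_sub_sub_mem [CompleteSpace E] [FiniteDimensional ℝ E] {T : E →L[ℝ] E} {W : Submodule ℝ E}
    (hT : ∀ w ∈ W, T w ∈ W) {z : E} (hz : T (T z) ∈ W) : exp T z - (z + T z) ∈ W := by
  have h := (hasSum_nat_add_iff' 2).2 (hasSum_exp_apply T z)
  simp only [Finset.sum_range_succ, Finset.sum_range_zero] at h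
  have h2 : exp T z - (z + T z) = exp T z - (0 + ((Nat.factorial 0 : ℕ) : ℝ)⁻¹ • (T ^ 0) z
      + ((Nat.factorial 1 : ℕ) : ℝ)⁻¹ • (T ^ 1) z) := by simp
  rw [h2]
  refine mem_of_hasSum h fun n => W.smul_mem _ ?_
  rw [pow_add, mul_apply_eq_comp]
  exact pow_apply_mem hT n (by simpa [pow_two] using hz)

variable {𝔸 : Type*} [NormedRing 𝔸] [NormedAlgebra ℝ 𝔸]

/-- `ad Y` as a continuous linear map. -/
def adL (Y : 𝔸) : 𝔸 →L[ℝ] 𝔸 :=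
  ContinuousLinearMap.mul ℝ 𝔸 Y + (ContinuousLinearMap.mul ℝ 𝔸).flip (-Y)

lemma adL_apply (Y Z : 𝔸) : adL Y Z = Y * Z - Z * Y := by simp [adL, sub_eq_add_neg]

/-- Left and right multiplications commute, so the exponential of `ad Y` splits as a product of
their exponentials. -/
lemma exp_adL_apply [CompleteSpace 𝔸] (Y Z : 𝔸) : exp (adL Y) Z = exp Y * Z * exp (-Y) := by
  have hl (Z : 𝔸) : exp (ContinuousLinearMap.mul ℝ 𝔸 Y) Z = exp Y * Z := by
    have hp (n : ℕ) : (ContinuousLinearMap.mul ℝ 𝔸 Y ^ n) Z = Y ^ n * Z := by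
      induction n with
      | zero => simp
      | succ n ih => rw [pow_succ', mul_apply_eq_comp, ih]; simp [pow_succ', mul_assoc]
    refine (hasSum_exp_apply _ Z).unique ?_
    simpa [hp] using (exp_series_hasSum_exp' (𝕂 := ℝ) Y).mul_right Z
  have hr (Z : 𝔸) : exp ((ContinuousLinearMap.mul ℝ 𝔸).flip (-Y)) Z = Z * exp (-Y) := by
    have hp (n : ℕ) : ((ContinuousLinearMap.mul ℝ 𝔸).flip (-Y) ^ n) Z = Z * (-Y) ^ n := by
      induction n with
      | zero => simp
      | succ n ih =>
        rw [pow_succ', mul_apply_eq_comp, ih, pow_succ, ← mul_assoc]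
        simp only [ContinuousLinearMap.flip_apply, ContinuousLinearMap.mul_apply']
    refine (hasSum_exp_apply _ Z).unique ?_
    have := (exp_series_hasSum_exp' (𝕂 := ℝ) (-Y)).mul_left Z
    simpa only [hp, mul_smul_comm] using this
  have hc : Commute (ContinuousLinearMap.mul ℝ 𝔸 Y) ((ContinuousLinearMap.mul ℝ 𝔸).flip (-Y)) := by
    ext Z
    simp [mul_assoc]
  let _ : NormedAlgebra ℚ (𝔸 →L[ℝ] 𝔸) := .restrictScalars ℚ ℝ _
  rw [adL, exp_add_of_commute hc, mul_apply_eq_comp, hr, hl, mul_assoc]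

end Exp

-- Joint eigenspaces indexed by linear forms

attribute [local instance] LieRing.ofAssociativeRing

/-- An eigenvalue function that has a nonzero joint eigenvector is automatically linear, so the
other functions contribute nothing. -/
lemma iSup_dual_jointEigenspace {N M : Type*} [AddCommGroup N] [Module ℝ N] [AddCommGroup M]
    [Module ℝ M] (f : N →ₗ[ℝ] Module.End ℝ M)
    (h : ⨆ χ : N → ℝ, ⨅ i, (f i).eigenspace (χ i) = ⊤) :
    ⨆ χ : Module.Dual ℝ N, ⨅ i, (f i).eigenspace (χ i) = ⊤ := by
  rw [eq_top_iff, ← h]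
  refine iSup_le fun χ => ?_
  by_cases h0 : ⨅ i, (f i).eigenspace (χ i) = ⊥
  · rw [h0]; exact bot_le
  obtain ⟨x, hx, hx0⟩ := (Submodule.ne_bot_iff _).1 h0
  have hx' (i : N) : f i x = χ i • x := by
    simpa using (Submodule.mem_iInf _).1 hx i
  let χ' : Module.Dual ℝ N :=
    { toFun := χ
      map_add' := fun i j => smul_left_injective ℝ hx0 (by
        change χ (i + j) • x = (χ i + χ j) • x
        rw [add_smul, ← hx', ← hx', ← hx', map_add, LinearMap.add_apply])
      map_smul' := fun c i => smul_left_injective ℝ hx0 (by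
        change χ (c • i) • x = (c • χ i) • x
        rw [smul_assoc, ← hx', ← hx', map_smul, LinearMap.smul_apply]) }
  exact le_iSup (fun χ : Module.Dual ℝ N => ⨅ i, (f i).eigenspace (χ i)) χ'

lemma iSupIndep_dual_jointEigenspace {N M : Type*} [AddCommGroup N] [Module ℝ N] [AddCommGroup M]
    [Module ℝ M] (f : N →ₗ[ℝ] Module.End ℝ M) (h : ∀ i j, Commute (f i) (f j)) :
    iSupIndep fun χ : Module.Dual ℝ N => ⨅ i, (f i).eigenspace (χ i) :=
  (iSupIndep_jointEigenspace (fun i => f i) h).comp (f := fun χ : Module.Dual ℝ N => (χ : N → ℝ))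
    DFunLike.coe_injective

variable {G V : Type*} [Group G] [NormedAddCommGroup V] [NormedSpace ℝ V]

namespace NonSwingingRep

variable (S : NonSwingingRep G V)

/-! ### The root space decomposition -/

/-- The inclusion of the Cartan subspace in the Lie algebra. -/
def incl : S.𝔞 →ₗ[ℝ] S.𝔤 where
  toFun H := ⟨H, (S.isMaximalAbelian.1 H H.2).1⟩
  map_add' _ _ := rfl
  map_smul' _ _ := rfl

@[simp] lemma coe_incl (H : S.𝔞) : (S.incl H : V →L[ℝ] V) = H := rfl

lemma theta_incl (H : S.𝔞) : S.θ (S.incl H) = -S.incl H :=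
  (S.isMaximalAbelian.1 H H.2).2

lemma incl_lie_incl (H K : S.𝔞) : ⁅S.incl H, S.incl K⁆ = 0 :=
  Subtype.ext (S.isMaximalAbelian.2.1 H H.2 K K.2)

/-- The adjoint action of the Cartan subspace. -/
def adA : S.𝔞 →ₗ[ℝ] Module.End ℝ S.𝔤 := (LieAlgebra.ad ℝ S.𝔤 : S.𝔤 →ₗ[ℝ] _) ∘ₗ S.incl

lemma adA_apply (H : S.𝔞) (X : S.𝔤) : S.adA H X = ⁅S.incl H, X⁆ := rfl

lemma adA_commute (H K : S.𝔞) : Commute (S.adA H) (S.adA K) := by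
  ext X : 1
  change ⁅S.incl H, ⁅S.incl K, X⁆⁆ = ⁅S.incl K, ⁅S.incl H, X⁆⁆
  rw [leibniz_lie, incl_lie_incl, zero_lie, zero_add]

/-- The restricted root space as a subspace of the Lie algebra. -/
def rsp (α : Module.Dual ℝ S.𝔞) : Submodule ℝ S.𝔤 := ⨅ H, (S.adA H).eigenspace (α H)

variable {S} in
lemma mem_rsp {α : Module.Dual ℝ S.𝔞} {X : S.𝔤} :
    X ∈ S.rsp α ↔ ∀ H, ⁅S.incl H, X⁆ = α H • X := by
  simp [rsp, adA_apply]

variable {S} in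
lemma mem_roots_of_rsp_ne_bot {α : Module.Dual ℝ S.𝔞} (h : S.rsp α ≠ ⊥) (h0 : α ≠ 0) :
    α ∈ roots S.𝔤 S.𝔞 := by
  obtain ⟨X, hX, hX0⟩ := (Submodule.ne_bot_iff _).1 h
  exact ⟨h0, X, ⟨X.2, fun H => congrArg Subtype.val (mem_rsp.1 hX H)⟩,
    fun h => hX0 (Subtype.ext h)⟩

/-- This is where splitness enters: there is no compact part in the centralizer of 𝔞. -/
lemma rsp_zero : S.rsp 0 = LinearMap.range S.incl := by
  ext X
  rw [mem_rsp]
  constructor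
  · intro h
    exact ⟨⟨X, S.split X X.2 fun H hH => by
      simpa using congrArg Subtype.val (h ⟨H, hH⟩)⟩, rfl⟩
  · rintro ⟨K, rfl⟩ H
    simp [incl_lie_incl]

lemma iSupIndep_rsp : iSupIndep S.rsp := iSupIndep_dual_jointEigenspace S.adA S.adA_commute

lemma lie_mem_rsp {α β : Module.Dual ℝ S.𝔞} {X Y : S.𝔤} (hX : X ∈ S.rsp α) (hY : Y ∈ S.rsp β) :
    ⁅X, Y⁆ ∈ S.rsp (α + β) := by
  rw [mem_rsp] at *
  intro H
  rw [leibniz_lie, hX, hY, smul_lie, lie_smul, LinearMap.add_apply, add_smul]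

lemma lie_mem_gradedSum {s t u : Set (Module.Dual ℝ S.𝔞)}
    (h : ∀ α ∈ s, ∀ β ∈ t, α + β ∈ u) {X Y : S.𝔤} (hX : X ∈ gradedSum S.rsp s)
    (hY : Y ∈ gradedSum S.rsp t) : ⁅X, Y⁆ ∈ gradedSum S.rsp u := by
  refine gradedSum_induction (p := fun X => ⁅X, Y⁆ ∈ gradedSum S.rsp u) (by simp)
    (fun x y hx hy => by rw [add_lie]; exact add_mem hx hy) (fun α hα X hX => ?_) hX
  refine gradedSum_induction (p := fun Y => ⁅X, Y⁆ ∈ gradedSum S.rsp u) (by simp)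
    (fun x y hx hy => by rw [lie_add]; exact add_mem hx hy) (fun β hβ Y hY => ?_) hY
  exact le_gradedSum (h α hα β hβ) (S.lie_mem_rsp hX hY)

/-! ### The Killing form -/

/-- The Killing form of the Lie algebra. -/
abbrev killing : LinearMap.BilinForm ℝ S.𝔤 := killingForm ℝ S.𝔤

lemma killing_comm (X Y : S.𝔤) : S.killing X Y = S.killing Y X :=
  LieModule.traceForm_comm ℝ S.𝔤 S.𝔤 X Y

lemma killing_theta (X Y : S.𝔤) : S.killing X (S.θ Y) = S.killing Y (S.θ X) := by
  rw [← LieAlgebra.killingForm_of_equiv_apply S.θ, S.isCartanInvolution.1, S.killing_comm]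

lemma killing_nondegenerate : S.killing.Nondegenerate := by
  have h (X : S.𝔤) (hX : ∀ Y, S.killing X Y = 0) : X = 0 := by
    by_contra h0
    exact (S.isCartanInvolution.2 X h0).ne (hX _)
  exact ⟨h, fun X hX => h X fun Y => by rw [S.killing_comm]; exact hX Y⟩

lemma killing_incl_pos {H : S.𝔞} (h : H ≠ 0) : 0 < S.killing (S.incl H) (S.incl H) := by
  have := S.isCartanInvolution.2 (S.incl H) fun h0 =>
    h (Subtype.ext (congrArg (Subtype.val : S.𝔤 → V →L[ℝ] V) h0))
  rwa [theta_incl, map_neg, neg_lt_zero] at this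

/-- Invariance of the Killing form under `ad H` gives `(α + β)(H) B(X, Y) = 0` for all `H`. -/
lemma killing_rsp {α β : Module.Dual ℝ S.𝔞} (h : α + β ≠ 0) {X Y : S.𝔤} (hX : X ∈ S.rsp α)
    (hY : Y ∈ S.rsp β) : S.killing X Y = 0 := by
  obtain ⟨H, hH⟩ : ∃ H, (α + β) H ≠ 0 := by
    by_contra! h0
    exact h (LinearMap.ext h0)
  have e : S.killing ⁅S.incl H, X⁆ Y = -S.killing X ⁅S.incl H, Y⁆ := by
    rw [← lie_skew, map_neg, LinearMap.neg_apply]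
    exact congrArg Neg.neg (LieModule.traceForm_apply_lie_apply ℝ S.𝔤 S.𝔤 X (S.incl H) Y)
  rw [mem_rsp.1 hX, mem_rsp.1 hY, map_smul, LinearMap.smul_apply, map_smul, smul_eq_mul,
    smul_eq_mul] at e
  have e2 : (α + β) H * S.killing X Y = 0 := by
    rw [LinearMap.add_apply]; linarith
  exact (mul_eq_zero.1 e2).resolve_left hH

lemma killing_gradedSum {s t : Set (Module.Dual ℝ S.𝔞)} (h : ∀ α ∈ s, ∀ β ∈ t, α + β ≠ 0)
    {X Y : S.𝔤} (hX : X ∈ gradedSum S.rsp s) (hY : Y ∈ gradedSum S.rsp t) :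
    S.killing X Y = 0 := by
  refine gradedSum_induction (p := fun X => S.killing X Y = 0) (by simp)
    (fun x y hx hy => by rw [map_add, LinearMap.add_apply, hx, hy, add_zero])
    (fun α hα X hX => ?_) hX
  refine gradedSum_induction (p := fun Y => S.killing X Y = 0) (by simp)
    (fun x y hx hy => by rw [map_add, hx, hy, add_zero]) (fun β hβ Y hY => ?_) hY
  exact S.killing_rsp (h α hα β hβ) hX hY

/-- As θ is -1 on 𝔞, each `ad H` is symmetric for the positive definite form `-B(X, θ Y)`, so the
adjoint action of 𝔞 is diagonalizable. -/
lemma iSup_rsp [FiniteDimensional ℝ V] : ⨆ α, S.rsp α = ⊤ := by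
  refine iSup_dual_jointEigenspace S.adA ?_
  let b : LinearMap.BilinForm ℝ S.𝔤 := -S.killing.compl₂ (S.θ : S.𝔤 →ₗ[ℝ] S.𝔤)
  have hb (X Y : S.𝔤) : b X Y = -S.killing X (S.θ Y) := rfl
  refine iSup_jointEigenspace_of_symmetric b ?_ ?_ _ ?_ S.adA_commute
  · intro X Y
    rw [hb, hb, S.killing_theta]
  · intro X hX
    rw [hb, neg_pos]
    exact S.isCartanInvolution.2 X hX
  · intro H X Y
    rw [hb, hb, adA_apply, adA_apply, LieEquiv.map_lie, theta_incl, ← lie_skew, neg_lie,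
      map_neg, map_neg, LinearMap.neg_apply]
    exact congrArg (- -·) (LieModule.traceForm_apply_lie_apply ℝ S.𝔤 S.𝔤 X (S.incl H) (S.θ Y))

lemma finite_rsp_ne_bot [FiniteDimensional ℝ V] : {α | S.rsp α ≠ ⊥}.Finite :=
  Submodule.finite_ne_bot_of_iSupIndep S.iSupIndep_rsp

/-! ### Positive roots -/

/-- A regular vector in the chosen Weyl chamber. -/
def H₀ : S.𝔞 := S.isOpenChamber.choose

lemma H₀_mem_regularSet : S.H₀ ∈ regularSet S.𝔤 S.𝔞 := S.isOpenChamber.choose_spec.1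

lemma chamber_eq : S.chamber = connectedComponentIn (regularSet S.𝔤 S.𝔞) S.H₀ :=
  S.isOpenChamber.choose_spec.2

/-- A root that is positive at `H₀` is nonnegative at `X₀`. -/
lemma nonneg_X₀ [FiniteDimensional ℝ V] {α : Module.Dual ℝ S.𝔞} (hα : S.rsp α ≠ ⊥)
    (h : 0 < α S.H₀) : 0 ≤ α S.X₀ := by
  have hroot : α ∈ roots S.𝔤 S.𝔞 := mem_roots_of_rsp_ne_bot hα fun h0 => by simp [h0] at h
  have hcont : Continuous α := α.continuous_of_finiteDimensional
  -- The chamber is connected and avoids the kernel of α, so α cannot change sign on it; the bound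
  -- then passes to the closure, where `X₀` lies.
  have hsub : S.chamber ⊆ {H | 0 ≤ α H} := by
    intro H hH
    by_contra hneg
    rw [Set.mem_ofPred_eq, not_le] at hneg
    rw [chamber_eq] at hH
    obtain ⟨K, hK, hK0⟩ := isPreconnected_connectedComponentIn.intermediate_value hH
      (mem_connectedComponentIn S.H₀_mem_regularSet) hcont.continuousOn ⟨hneg.le, h.le⟩
    exact connectedComponentIn_subset _ _ hK α hroot hK0
  exact closure_minimal hsub (isClosed_le continuous_const hcont) S.mem_chamber

/-- The nilradical: the sum of the root spaces of the roots that are at least `c` at `H₀`. -/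
def nilGE (c : ℝ) : Submodule ℝ S.𝔤 := gradedSum S.rsp {α | c ≤ α S.H₀}

/-- The sum of the positive root spaces. -/
def nil : Submodule ℝ S.𝔤 := gradedSum S.rsp {α | 0 < α S.H₀}

/-- The Borel subalgebra. -/
def borel : Submodule ℝ S.𝔤 := LinearMap.range S.incl ⊔ S.nil

lemma nil_le_borel : S.nil ≤ S.borel := le_sup_right

lemma sup_neg_eq_top [FiniteDimensional ℝ V] :
    S.borel ⊔ gradedSum S.rsp {α | α S.H₀ < 0} = ⊤ := by
  rw [eq_top_iff, ← S.iSup_rsp]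
  refine iSup_le fun α => ?_
  by_cases h0 : α = 0
  · rw [h0, rsp_zero]; exact le_sup_of_le_left le_sup_left
  by_cases hb : S.rsp α = ⊥
  · rw [hb]; exact bot_le
  rcases lt_trichotomy (α S.H₀) 0 with h | h | h
  · exact le_sup_of_le_right (le_gradedSum h)
  · exact absurd h (S.H₀_mem_regularSet α (mem_roots_of_rsp_ne_bot hb h0))
  · exact le_sup_of_le_left (le_sup_of_le_right (le_gradedSum h))

lemma range_incl_eq : LinearMap.range S.incl = gradedSum S.rsp {0} := by
  rw [gradedSum_singleton, rsp_zero]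

lemma add_ne_zero_of_pos : ∀ α ∈ {α : Module.Dual ℝ S.𝔞 | 0 < α S.H₀},
    ∀ β ∈ {α : Module.Dual ℝ S.𝔞 | 0 < α S.H₀}, α + β ≠ 0 := by
  intro α hα β hβ h
  rw [Set.mem_ofPred_eq] at hα hβ
  have : (α + β) S.H₀ = 0 := by rw [h, LinearMap.zero_apply]
  rw [LinearMap.add_apply] at this
  linarith

lemma add_ne_zero_of_neg : ∀ α ∈ {α : Module.Dual ℝ S.𝔞 | α S.H₀ < 0},
    ∀ β ∈ {α : Module.Dual ℝ S.𝔞 | α S.H₀ < 0}, α + β ≠ 0 := by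
  intro α hα β hβ h
  rw [Set.mem_ofPred_eq] at hα hβ
  have : (α + β) S.H₀ = 0 := by rw [h, LinearMap.zero_apply]
  rw [LinearMap.add_apply] at this
  linarith

lemma killing_nil_nil {X Y : S.𝔤} (hX : X ∈ S.nil) (hY : Y ∈ S.nil) : S.killing X Y = 0 :=
  S.killing_gradedSum S.add_ne_zero_of_pos hX hY

lemma killing_incl_nil (H : S.𝔞) {Y : S.𝔤} (hY : Y ∈ S.nil) : S.killing (S.incl H) Y = 0 :=
  S.killing_gradedSum (s := {0}) (fun α hα β hβ h => by
    rw [Set.mem_singleton_iff] at hα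
    rw [Set.mem_ofPred_eq] at hβ
    rw [hα, zero_add] at h
    simp [h] at hβ) (by rw [← range_incl_eq]; exact ⟨H, rfl⟩) hY

/-- Positive root spaces pair to zero with 𝔞 and with each other. Conversely, the negative component
of a vector orthogonal to 𝔫 is orthogonal to all of 𝔤, hence zero. -/
lemma orthogonal_nil [FiniteDimensional ℝ V] : S.killing.orthogonal S.nil = S.borel := by
  apply le_antisymm
  · intro X hX
    rw [LinearMap.BilinForm.mem_orthogonal_iff] at hX
    obtain ⟨Y, hY, Z, hZ, rfl⟩ :=
      Submodule.mem_sup.1 (S.sup_neg_eq_top ▸ Submodule.mem_top : X ∈ S.borel ⊔ _)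
    suffices hZ0 : Z = 0 by rwa [hZ0, add_zero]
    refine S.killing_nondegenerate.1 Z fun W => ?_
    obtain ⟨P, hP, Q, hQ, rfl⟩ :=
      Submodule.mem_sup.1 (S.sup_neg_eq_top ▸ Submodule.mem_top : W ∈ S.borel ⊔ _)
    obtain ⟨-, ⟨H, rfl⟩, N, hN, rfl⟩ := Submodule.mem_sup.1 hP
    obtain ⟨-, ⟨K, rfl⟩, N', hN', rfl⟩ := Submodule.mem_sup.1 hY
    have e1 : S.killing Z Q = 0 :=
      S.killing_gradedSum S.add_ne_zero_of_neg hZ hQ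
    have e2 : S.killing Z (S.incl H) = 0 :=
      S.killing_gradedSum (t := {0}) (fun α hα β hβ h => by
        rw [Set.mem_singleton_iff] at hβ
        rw [Set.mem_ofPred_eq] at hα
        rw [hβ, add_zero] at h
        simp [h] at hα) hZ (by rw [← range_incl_eq]; exact ⟨H, rfl⟩)
    have e3 := hX N hN
    rw [map_add, map_add, S.killing_nil_nil hN hN', S.killing_comm, S.killing_incl_nil K hN,
      S.killing_comm] at e3
    rw [map_add, map_add, e1, e2]
    simpa using e3
  · refine sup_le ?_ ?_
    · rintro - ⟨H, rfl⟩ Y hY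
      exact (S.killing_comm _ _).trans (S.killing_incl_nil H hY)
    · intro X hX Y hY
      exact S.killing_nil_nil hY hX

/-- On 𝔟 the Killing form sees only the 𝔞-component, where it is positive definite. -/
lemma mem_nil_of_isotropic {X : S.𝔤} (hX : X ∈ S.borel) (h : S.killing X X = 0) : X ∈ S.nil := by
  obtain ⟨-, ⟨H, rfl⟩, N, hN, rfl⟩ := Submodule.mem_sup.1 hX
  rw [LinearMap.map_add₂, map_add, map_add, S.killing_nil_nil hN hN,
    S.killing_incl_nil H hN, S.killing_comm N, S.killing_incl_nil H hN, add_zero, add_zero,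
    add_zero] at h
  have hH : H = 0 := by
    by_contra h0
    exact (S.killing_incl_pos h0).ne' h
  rwa [hH, map_zero, zero_add]

end NonSwingingRep

/-! ### Sums of eigenspaces of a single endomorphism -/

/-- The sum of the eigenspaces of `T` with eigenvalue in `s`. -/
def eigenSum (T : V →L[ℝ] V) (s : Set ℝ) : Submodule ℝ V :=
  gradedSum (fun c => Module.End.eigenspace (T : Module.End ℝ V) c) s

lemma eigenSum_disjoint (T : V →L[ℝ] V) {s t : Set ℝ} (h : Disjoint s t) :
    Disjoint (eigenSum T s) (eigenSum T t) :=
  gradedSum_disjoint (Module.End.eigenspaces_iSupIndep _) h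

lemma eigenSum_inf (T : V →L[ℝ] V) (s t : Set ℝ) :
    eigenSum T s ⊓ eigenSum T t = eigenSum T (s ∩ t) :=
  gradedSum_inf (Module.End.eigenspaces_iSupIndep _) s t

lemma eigenSum_sup (T : V →L[ℝ] V) (s t : Set ℝ) :
    eigenSum T s ⊔ eigenSum T t = eigenSum T (s ∪ t) :=
  (gradedSum_union s t).symm

lemma eigenSum_neg (T : V →L[ℝ] V) (s : Set ℝ) : eigenSum (-T) s = eigenSum T (-s) := by
  have h (c : ℝ) : Module.End.eigenspace ((-T : V →L[ℝ] V) : Module.End ℝ V) c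
      = Module.End.eigenspace (T : Module.End ℝ V) (-c) := by
    ext v
    simp [neg_eq_iff_eq_neg]
  apply le_antisymm
  · refine gradedSum_le fun c hc => ?_
    rw [h]
    exact le_gradedSum (E := fun c => Module.End.eigenspace (T : Module.End ℝ V) c) (by simpa)
  · refine gradedSum_le fun c hc => ?_
    have := h (-c)
    rw [neg_neg] at this
    rw [← this]
    exact le_gradedSum
      (E := fun c => Module.End.eigenspace ((-T : V →L[ℝ] V) : Module.End ℝ V) c) hc

lemma linear_mem_polynomialFunctions (φ : Module.Dual ℝ (V →L[ℝ] V)) :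
    (φ : (V →L[ℝ] V) → ℝ) ∈ polynomialFunctions V :=
  Algebra.subset_adjoin ⟨φ, rfl⟩

namespace NonSwingingRep

variable (S : NonSwingingRep G V)

/-! ### The action of the group -/

@[simp] lemma R_mul_apply (g h : G) (v : V) : S.R (g * h) v = S.R g (S.R h v) := by
  rw [map_mul]; rfl

@[simp] lemma R_inv_apply_apply (g : G) (v : V) : S.R g⁻¹ (S.R g v) = v := by
  rw [← R_mul_apply, inv_mul_cancel, map_one]; rfl

@[simp] lemma R_apply_inv_apply (g : G) (v : V) : S.R g (S.R g⁻¹ v) = v := by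
  rw [← R_mul_apply, mul_inv_cancel, map_one]; rfl

lemma R_injective (g : G) : Function.Injective (S.R g) :=
  Function.LeftInverse.injective (S.R_inv_apply_apply g)

lemma R_mul_R_inv (g : G) : S.R g * S.R g⁻¹ = 1 := by rw [← map_mul, mul_inv_cancel, map_one]

lemma R_inv_mul_R (g : G) : S.R g⁻¹ * S.R g = 1 := by rw [← map_mul, inv_mul_cancel, map_one]

lemma translate_mul (g h : G) (W : Submodule ℝ V) :
    S.translate (g * h) W = S.translate g (S.translate h W) := by
  rw [translate, translate, translate, ← Submodule.map_comp]
  congr 1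
  ext v
  simp

lemma translate_one (W : Submodule ℝ V) : S.translate 1 W = W := by
  have : ((S.R 1 : V →L[ℝ] V) : V →ₗ[ℝ] V) = LinearMap.id := by rw [map_one]; rfl
  rw [translate, this, Submodule.map_id]

lemma translate_inv_translate (g : G) (W : Submodule ℝ V) :
    S.translate g⁻¹ (S.translate g W) = W := by
  rw [← translate_mul, inv_mul_cancel, translate_one]

lemma translate_translate_inv (g : G) (W : Submodule ℝ V) :
    S.translate g (S.translate g⁻¹ W) = W := by
  rw [← translate_mul, mul_inv_cancel, translate_one]

lemma translate_injective (g : G) : Function.Injective (S.translate g) :=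
  Function.LeftInverse.injective (S.translate_inv_translate g)

lemma translate_mono (g : G) {W₁ W₂ : Submodule ℝ V} (h : W₁ ≤ W₂) :
    S.translate g W₁ ≤ S.translate g W₂ :=
  Submodule.map_mono h

lemma translate_sup (g : G) (W₁ W₂ : Submodule ℝ V) :
    S.translate g (W₁ ⊔ W₂) = S.translate g W₁ ⊔ S.translate g W₂ :=
  Submodule.map_sup _ _ _

lemma translate_top (g : G) : S.translate g ⊤ = ⊤ := by
  rw [eq_top_iff]
  intro v _
  exact ⟨S.R g⁻¹ v, Submodule.mem_top, S.R_apply_inv_apply g v⟩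

lemma apply_mem_translate (g : G) {W : Submodule ℝ V} {v : V} (h : v ∈ W) :
    S.R g v ∈ S.translate g W :=
  ⟨v, h, rfl⟩

lemma mem_translate {g : G} {W : Submodule ℝ V} {v : V} :
    v ∈ S.translate g W ↔ S.R g⁻¹ v ∈ W := by
  constructor
  · rintro ⟨w, hw, rfl⟩
    simpa using hw
  · intro h
    simpa using S.apply_mem_translate g h


lemma finrank_translate (g : G) (W : Submodule ℝ V) :
    Module.finrank ℝ (S.translate g W) = Module.finrank ℝ W :=
  (Submodule.equivMapOfInjective (S.R g : V →ₗ[ℝ] V) (S.R_injective g) W).finrank_eq.symm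

lemma Ad_mul (g h : G) (X : V →L[ℝ] V) : Ad S.R (g * h) X = Ad S.R g (Ad S.R h X) := by
  simp only [Ad, mul_inv_rev, map_mul, mul_assoc]

lemma Ad_one (X : V →L[ℝ] V) : Ad S.R 1 X = X := by
  simp [Ad]

lemma Ad_inv_Ad (g : G) (X : V →L[ℝ] V) : Ad S.R g⁻¹ (Ad S.R g X) = X := by
  rw [← Ad_mul, inv_mul_cancel, Ad_one]

lemma Ad_lie (g : G) (X Y : V →L[ℝ] V) : Ad S.R g ⁅X, Y⁆ = ⁅Ad S.R g X, Ad S.R g Y⁆ := by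
  have h (X Y : V →L[ℝ] V) : Ad S.R g (X * Y) = Ad S.R g X * Ad S.R g Y := by
    simp only [Ad]
    calc S.R g * (X * Y) * S.R g⁻¹ = S.R g * X * 1 * Y * S.R g⁻¹ := by
          simp only [mul_assoc, mul_one]
      _ = _ := by rw [← S.R_inv_mul_R g]; simp only [mul_assoc]
  rw [Ring.lie_def, Ring.lie_def, ← h, ← h]
  simp only [Ad, mul_sub, sub_mul]

lemma Ad_apply_R (g : G) (X : V →L[ℝ] V) (v : V) : Ad S.R g X (S.R g v) = S.R g (X v) := by
  simp [Ad]

lemma translate_eigenSum (g : G) (T : V →L[ℝ] V) (s : Set ℝ) :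
    S.translate g (eigenSum T s) = eigenSum (Ad S.R g T) s := by
  have h (g : G) (T : V →L[ℝ] V) : S.translate g (eigenSum T s) ≤ eigenSum (Ad S.R g T) s := by
    rw [translate, eigenSum, gradedSum_map]
    refine gradedSum_le fun c hc => le_trans ?_ (le_gradedSum hc)
    rintro - ⟨v, hv, rfl⟩
    rw [SetLike.mem_coe, Module.End.mem_eigenspace_iff] at hv
    rw [Module.End.mem_eigenspace_iff]
    change Ad S.R g T (S.R g v) = c • S.R g v
    rw [Ad_apply_R, ← map_smul]
    exact congrArg _ hv
  refine le_antisymm (h g T) ?_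
  have h2 := S.translate_mono g (h g⁻¹ (Ad S.R g T))
  rwa [translate_translate_inv, Ad_inv_Ad] at h2

/-! ### Exponentials in the group -/

section Exp

variable [CompleteSpace V]

lemma exp_conj_R (g : G) (X : V →L[ℝ] V) :
    NormedSpace.exp (Ad S.R g X) = S.R g * NormedSpace.exp X * S.R g⁻¹ := by
  let _ : NormedAlgebra ℚ (V →L[ℝ] V) := .restrictScalars ℚ ℝ _
  let u : (V →L[ℝ] V)ˣ := ⟨S.R g, S.R g⁻¹, S.R_mul_R_inv g, S.R_inv_mul_R g⟩
  exact NormedSpace.exp_units_conj u X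

lemma exp_mul_exp_neg (X : V →L[ℝ] V) : NormedSpace.exp X * NormedSpace.exp (-X) = 1 := by
  let _ : NormedAlgebra ℚ (V →L[ℝ] V) := .restrictScalars ℚ ℝ _
  rw [← NormedSpace.exp_add_of_commute (Commute.refl X).neg_right, add_neg_cancel,
    NormedSpace.exp_zero]

lemma R_inv_eq_exp_neg {g : G} {X : V →L[ℝ] V} (h : S.R g = NormedSpace.exp X) :
    S.R g⁻¹ = NormedSpace.exp (-X) := by
  rw [← mul_one (S.R g⁻¹), ← exp_mul_exp_neg X, ← h, ← mul_assoc, R_inv_mul_R, one_mul]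

lemma exists_R_eq_exp (X : S.𝔤) : ∃ g, S.R g = NormedSpace.exp (X : V →L[ℝ] V) := by
  simpa using (S.isLieAlgebra X).1 X.2 1

lemma Ad_mem (g : G) {X : V →L[ℝ] V} (hX : X ∈ S.𝔤) : Ad S.R g X ∈ S.𝔤 := by
  rw [S.isLieAlgebra] at hX ⊢
  intro t
  obtain ⟨h, hh⟩ := hX t
  refine ⟨g * h * g⁻¹, ?_⟩
  have : t • Ad S.R g X = Ad S.R g (t • X) := by simp [Ad]
  rw [this, exp_conj_R, ← hh, map_mul, map_mul]

/-- `Ad_g` as an automorphism of the Lie algebra. -/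
def adEquiv (g : G) : S.𝔤 ≃ₗ⁅ℝ⁆ S.𝔤 where
  toFun X := ⟨Ad S.R g X, S.Ad_mem g X.2⟩
  map_add' X Y := Subtype.ext (by simp [Ad, mul_add, add_mul])
  map_smul' c X := Subtype.ext (by simp [Ad])
  map_lie' := fun {X Y} => Subtype.ext (S.Ad_lie g X Y)
  invFun X := ⟨Ad S.R g⁻¹ X, S.Ad_mem g⁻¹ X.2⟩
  left_inv X := Subtype.ext (S.Ad_inv_Ad g X)
  right_inv X := Subtype.ext (by simpa using S.Ad_inv_Ad g⁻¹ X)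

@[simp] lemma coe_adEquiv (g : G) (X : S.𝔤) : (S.adEquiv g X : V →L[ℝ] V) = Ad S.R g X := rfl

lemma adEquiv_mul (g h : G) (X : S.𝔤) : S.adEquiv (g * h) X = S.adEquiv g (S.adEquiv h X) :=
  Subtype.ext (S.Ad_mul g h X)

lemma adEquiv_inv_adEquiv (g : G) (X : S.𝔤) : S.adEquiv g⁻¹ (S.adEquiv g X) = X :=
  Subtype.ext (S.Ad_inv_Ad g X)

lemma adEquiv_adEquiv_inv (g : G) (X : S.𝔤) : S.adEquiv g (S.adEquiv g⁻¹ X) = X := by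
  simpa using S.adEquiv_inv_adEquiv g⁻¹ X

lemma translate_eq_of_exp [FiniteDimensional ℝ V] {g : G} {X : V →L[ℝ] V}
    (hg : S.R g = NormedSpace.exp X) {W : Submodule ℝ V} (hW : ∀ v ∈ W, X v ∈ W) :
    S.translate g W = W := by
  apply le_antisymm
  · rintro - ⟨v, hv, rfl⟩
    change S.R g v ∈ W
    rw [hg]
    exact exp_apply_mem hW hv
  · intro v hv
    rw [mem_translate, S.R_inv_eq_exp_neg hg]
    exact exp_apply_mem (fun v hv => W.neg_mem (hW v hv)) hv

lemma translate_eq_of_mem_closure {s : Set G} {W : Submodule ℝ V}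
    (h : ∀ g ∈ s, S.translate g W = W) {g : G} (hg : g ∈ Subgroup.closure s) :
    S.translate g W = W := by
  induction hg using Subgroup.closure_induction with
  | mem g hg => exact h g hg
  | one => exact S.translate_one W
  | mul g k _ _ hg hk => rw [translate_mul, hk, hg]
  | inv g _ hg =>
    conv_lhs => rw [← hg]
    rw [translate_inv_translate]

end Exp

/-! ### The weight space decomposition -/

/-- The action of the Cartan subspace on `V`. -/
def actA : S.𝔞 →ₗ[ℝ] Module.End ℝ V where
  toFun H := ((H : V →L[ℝ] V) : V →ₗ[ℝ] V)
  map_add' _ _ := rfl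
  map_smul' _ _ := rfl

lemma weightSpace_eq (μ : Module.Dual ℝ S.𝔞) :
    weightSpace S.𝔞 μ = ⨅ H, (S.actA H).eigenspace (μ H) := by
  ext v
  simp only [Submodule.mem_iInf, Module.End.mem_eigenspace_iff]
  rfl

lemma actA_commute (H K : S.𝔞) : Commute (S.actA H) (S.actA K) := by
  have h := S.isMaximalAbelian.2.1 H H.2 K K.2
  rw [Ring.lie_def, sub_eq_zero] at h
  ext v
  exact congrArg (fun T : V →L[ℝ] V => T v) h

lemma iSupIndep_weightSpace : iSupIndep (weightSpace S.𝔞) := by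
  have : weightSpace S.𝔞 = fun μ : Module.Dual ℝ S.𝔞 => ⨅ H, (S.actA H).eigenspace (μ H) :=
    funext S.weightSpace_eq
  rw [this]
  exact iSupIndep_dual_jointEigenspace S.actA S.actA_commute

lemma apply_mem_weightSpace {α μ : Module.Dual ℝ S.𝔞} {X : S.𝔤} (hX : X ∈ S.rsp α) {v : V}
    (hv : v ∈ weightSpace S.𝔞 μ) : (X : V →L[ℝ] V) v ∈ weightSpace S.𝔞 (μ + α) := by
  intro H
  have h := congrArg (fun T : S.𝔤 => (T : V →L[ℝ] V) v) (mem_rsp.1 hX H)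
  have h2 : (H : V →L[ℝ] V) ((X : V →L[ℝ] V) v) - (X : V →L[ℝ] V) ((H : V →L[ℝ] V) v)
      = α H • (X : V →L[ℝ] V) v := h
  rw [hv H, map_smul, sub_eq_iff_eq_add] at h2
  rw [h2, LinearMap.add_apply, add_smul, add_comm]

lemma apply_mem_gradedSum {s t u : Set (Module.Dual ℝ S.𝔞)} (h : ∀ α ∈ s, S.rsp α ≠ ⊥ →
    ∀ μ ∈ t, μ + α ∈ u) {X : S.𝔤} (hX : X ∈ gradedSum S.rsp s) {v : V}
    (hv : v ∈ gradedSum (weightSpace S.𝔞) t) :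
    (X : V →L[ℝ] V) v ∈ gradedSum (weightSpace S.𝔞) u := by
  refine gradedSum_induction
    (p := fun X : S.𝔤 => (X : V →L[ℝ] V) v ∈ gradedSum (weightSpace S.𝔞) u)
    (zero_mem _) (fun x y hx hy => add_mem hx hy) (fun α hα X hX => ?_) hX
  refine gradedSum_induction
    (p := fun v => (X : V →L[ℝ] V) v ∈ gradedSum (weightSpace S.𝔞) u) ?_
    (fun x y hx hy => ?_) (fun μ hμ v hv => ?_) hv
  · rw [map_zero]; exact zero_mem _
  · rw [map_add]; exact add_mem hx hy
  · by_cases h0 : S.rsp α = ⊥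
    · rw [h0, Submodule.mem_bot] at hX
      rw [hX]
      exact zero_mem _
    · exact le_gradedSum (h α hα h0 μ hμ) (S.apply_mem_weightSpace hX hv)

lemma gradedSum_rsp_univ [FiniteDimensional ℝ V] : gradedSum S.rsp Set.univ = ⊤ := by
  rw [gradedSum_univ, iSup_rsp]

/-- A subspace that is stable under the Lie algebra is stable under the group. -/
lemma R_apply_mem_of_lie_stable [FiniteDimensional ℝ V] [CompleteSpace V] {W : Submodule ℝ V}
    (hW : ∀ X ∈ S.𝔤, ∀ v ∈ W, X v ∈ W) (g : G) {v : V} (hv : v ∈ W) : S.R g v ∈ W := by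
  have hid (g : G) (hg : g ∈ identityComponent S.R S.𝔤) : S.translate g W = W :=
    S.translate_eq_of_mem_closure (s := {k | ∃ X ∈ S.𝔤, S.R k = NormedSpace.exp X}) (by
      rintro k ⟨X, hX, hk⟩
      exact S.translate_eq_of_exp hk (hW X hX)) hg
  -- Membership in `W` is tested by the linear forms `φ` that vanish on `W`. Each `T ↦ φ (T v)` is a
  -- linear function of the endomorphism, so its vanishing spreads from the identity component to
  -- the group by Zariski density.
  rw [← Subspace.dualAnnihilator_dualCoannihilator_eq (W := W), Submodule.mem_dualCoannihilator]
  intro φ hφ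
  rw [Submodule.mem_dualAnnihilator] at hφ
  let ψ : Module.Dual ℝ (V →L[ℝ] V) :=
    φ ∘ₗ (ContinuousLinearMap.apply ℝ V v : (V →L[ℝ] V) →ₗ[ℝ] V)
  refine S.zariskiConnected ψ (linear_mem_polynomialFunctions ψ) (fun k hk => hφ _ ?_) g
  change S.R k v ∈ W
  rw [← hid k hk]
  exact S.apply_mem_translate k hv

/-- The Cartan subspace acts diagonalizably on `V`. -/
lemma gradedSum_weightSpace_univ [FiniteDimensional ℝ V] [CompleteSpace V] :
    gradedSum (weightSpace S.𝔞) Set.univ = ⊤ := by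
  have hst (X : V →L[ℝ] V) (hX : X ∈ S.𝔤) (v : V)
      (hv : v ∈ gradedSum (weightSpace S.𝔞) Set.univ) :
      X v ∈ gradedSum (weightSpace S.𝔞) Set.univ :=
    S.apply_mem_gradedSum (s := Set.univ) (X := ⟨X, hX⟩) (fun _ _ _ _ _ => Set.mem_univ _)
      (by rw [gradedSum_rsp_univ]; exact Submodule.mem_top) hv
  -- The sum of the weight spaces is stable under the group and nonzero because 0 is a weight, so
  -- irreducibility applies.
  refine (S.irreducible _ fun g v hv => S.R_apply_mem_of_lie_stable hst g hv).resolve_left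
    fun h => S.zero_mem_weights ?_
  rw [eq_bot_iff, ← h]
  exact le_gradedSum (Set.mem_univ _)

/-- The inclusion into eigenspaces holds for `s` and for its complement; the weight sums together
fill `V` and the eigenspace sums are disjoint, so both inclusions are equalities. -/
lemma gradedSum_weightSpace_eq [FiniteDimensional ℝ V] [CompleteSpace V] (X : S.𝔞) (s : Set ℝ) :
    gradedSum (weightSpace S.𝔞) {μ | μ X ∈ s} = eigenSum X s := by
  have h (s : Set ℝ) : gradedSum (weightSpace S.𝔞) {μ | μ X ∈ s} ≤ eigenSum X s :=
    gradedSum_le fun μ hμ => le_trans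
      (fun v hv => Module.End.mem_eigenspace_iff.2 (hv X)) (le_gradedSum hμ)
  refine eq_of_le_of_inf_le_of_sup_le (z := gradedSum (weightSpace S.𝔞) {μ | μ X ∈ sᶜ}) (h s) ?_ ?_
  · exact le_trans (inf_le_inf_left _ (h sᶜ))
      ((eigenSum_disjoint _ disjoint_compl_right).le_bot.trans bot_le)
  · rw [← gradedSum_union]
    have : {μ : Module.Dual ℝ S.𝔞 | μ X ∈ s} ∪ {μ | μ X ∈ sᶜ} = Set.univ := by
      ext μ
      simp [em]
    rw [this, gradedSum_weightSpace_univ]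
    exact le_top

end NonSwingingRep

namespace NonSwingingRep

variable (S : NonSwingingRep G V)

/-! ### The unipotent radical -/

/-- The unipotent group generated by the exponentials of the positive root vectors. -/
def expNil : Subgroup G :=
  Subgroup.closure {g | ∃ Y ∈ S.nil, S.R g = NormedSpace.exp (Y : V →L[ℝ] V)}

variable {S} in
lemma rsp_ne_bot_of_mem_roots {α : Module.Dual ℝ S.𝔞} (h : α ∈ roots S.𝔤 S.𝔞) :
    S.rsp α ≠ ⊥ := by
  obtain ⟨-, X, ⟨hX, hX'⟩, hX0⟩ := h
  exact (Submodule.ne_bot_iff _).2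
    ⟨⟨X, hX⟩, mem_rsp.2 fun H => Subtype.ext (hX' H), fun h0 => hX0 (congrArg Subtype.val h0)⟩

/-- A regular `H` acts on each root space by a nonzero scalar. The filtration is measured by `H₀`,
because `H` may lie in a different chamber. -/
lemma exists_lie_eq {H : S.𝔞} (hH : H ∈ regularSet S.𝔤 S.𝔞) {c : ℝ} (hc : 0 < c) {X : S.𝔤}
    (hX : X ∈ S.nilGE c) : ∃ Y ∈ S.nilGE c, ⁅S.incl H, Y⁆ = X := by
  refine gradedSum_induction (p := fun X => ∃ Y ∈ S.nilGE c, ⁅S.incl H, Y⁆ = X)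
    ⟨0, zero_mem _, by simp⟩ ?_ ?_ hX
  · rintro - - ⟨Y, hY, rfl⟩ ⟨Z, hZ, rfl⟩
    exact ⟨Y + Z, add_mem hY hZ, lie_add _ _ _⟩
  · intro α hα' X hX
    have hα : c ≤ α S.H₀ := by rwa [Set.mem_ofPred_eq] at hα'
    by_cases h0 : X = 0
    · exact ⟨0, zero_mem _, by simp [h0]⟩
    have hαH : α H ≠ 0 := by
      refine hH α (mem_roots_of_rsp_ne_bot ((Submodule.ne_bot_iff _).2 ⟨X, hX, h0⟩) fun h => ?_)
      rw [h, LinearMap.zero_apply] at hα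
      exact hc.not_ge hα
    refine ⟨(α H)⁻¹ • X, Submodule.smul_mem _ _ (le_gradedSum hα' hX), ?_⟩
    rw [lie_smul, mem_rsp.1 hX, smul_smul, inv_mul_cancel₀ hαH, one_smul]

lemma nilGE_mono {c d : ℝ} (h : c ≤ d) : S.nilGE d ≤ S.nilGE c :=
  gradedSum_mono fun α hα => by
    rw [Set.mem_ofPred_eq] at hα ⊢
    exact h.trans hα

lemma nilGE_le_nil {c : ℝ} (h : 0 < c) : S.nilGE c ≤ S.nil :=
  gradedSum_mono fun α hα => by
    rw [Set.mem_ofPred_eq] at hα ⊢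
    exact h.trans_le hα

lemma lie_mem_nilGE {c d : ℝ} {X Y : S.𝔤} (hX : X ∈ S.nilGE c) (hY : Y ∈ S.nilGE d) :
    ⁅X, Y⁆ ∈ S.nilGE (c + d) :=
  S.lie_mem_gradedSum (fun α hα β hβ => by
    rw [Set.mem_ofPred_eq] at hα hβ ⊢
    exact add_le_add hα hβ) hX hY

variable [FiniteDimensional ℝ V] [CompleteSpace V]

lemma adEquiv_sub_sub_mem {g : G} {Y : S.𝔤} (hg : S.R g = NormedSpace.exp (Y : V →L[ℝ] V))
    {W : Submodule ℝ S.𝔤} (hW : ∀ Z ∈ W, ⁅Y, Z⁆ ∈ W) {Z : S.𝔤} (hZ : ⁅Y, ⁅Y, Z⁆⁆ ∈ W) :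
    S.adEquiv g Z - (Z + ⁅Y, Z⁆) ∈ W := by
  have had (Z : S.𝔤) : adL (Y : V →L[ℝ] V) Z = ((⁅Y, Z⁆ : S.𝔤) : V →L[ℝ] V) := by
    rw [adL_apply]; rfl
  have h := exp_apply_sub_sub_mem (T := adL (Y : V →L[ℝ] V))
    (W := W.map S.𝔤.toSubmodule.subtype) (z := (Z : V →L[ℝ] V)) (by
      rintro - ⟨Z, hZ, rfl⟩
      exact ⟨⁅Y, Z⁆, hW Z hZ, (had Z).symm⟩) (by
      rw [had, had]
      exact ⟨_, hZ, rfl⟩)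
  rw [exp_adL_apply, ← hg, ← S.R_inv_eq_exp_neg hg, had] at h
  obtain ⟨X, hX, hX'⟩ := h
  have : X = S.adEquiv g Z - (Z + ⁅Y, Z⁆) := Subtype.ext hX'
  rwa [← this]

/-- Choose `Y` with `[H, Y] = X`. In the expansion of `exp(ad Y)(H + X)` the term `[Y, H] = -X`
cancels `X`, and all remaining terms lie at least twice as deep in the filtration. -/
lemma exists_conj_step {H : S.𝔞} (hH : H ∈ regularSet S.𝔤 S.𝔞) {c : ℝ} (hc : 0 < c) {X : S.𝔤}
    (hX : X ∈ S.nilGE c) :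
    ∃ u ∈ S.expNil, ∃ X' ∈ S.nilGE (2 * c), S.adEquiv u (S.incl H + X) = S.incl H + X' := by
  obtain ⟨Y, hY, hYX⟩ := S.exists_lie_eq hH hc hX
  obtain ⟨u, hu⟩ := S.exists_R_eq_exp Y
  have h2 : ⁅Y, X⁆ ∈ S.nilGE (2 * c) := by
    rw [two_mul]; exact S.lie_mem_nilGE hY hX
  have hY1 : ⁅Y, S.incl H + X⁆ = -X + ⁅Y, X⁆ := by rw [lie_add, ← lie_skew, hYX]
  have hst (Z : S.𝔤) (hZ : Z ∈ S.nilGE (2 * c)) : ⁅Y, Z⁆ ∈ S.nilGE (2 * c) :=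
    S.nilGE_mono (by linarith) (S.lie_mem_nilGE hY hZ)
  have h := S.adEquiv_sub_sub_mem hu (W := S.nilGE (2 * c)) hst (Z := S.incl H + X) (by
    rw [hY1, lie_add, lie_neg]
    exact add_mem (neg_mem h2) (hst _ h2))
  refine ⟨u, Subgroup.subset_closure ⟨Y, S.nilGE_le_nil hc hY, hu⟩, _, add_mem h h2, ?_⟩
  rw [hY1]
  abel

lemma exists_forall_lt : ∃ C : ℝ, ∀ α, S.rsp α ≠ ⊥ → α S.H₀ < C := by
  obtain ⟨C, hC⟩ := (S.finite_rsp_ne_bot.image fun α => α S.H₀).bddAbove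
  exact ⟨C + 1, fun α hα => (hC ⟨α, hα, rfl⟩).trans_lt (lt_add_one C)⟩

/-- Only finitely many roots exist, so their positive values at `H₀` have a positive lower bound. -/
lemma exists_nil_le_nilGE : ∃ c : ℝ, 0 < c ∧ S.nil ≤ S.nilGE c := by
  have h : ∀ᶠ c in nhdsWithin (0 : ℝ) (Set.Ioi 0),
      ∀ α ∈ {α | S.rsp α ≠ ⊥}, 0 < α S.H₀ → c ≤ α S.H₀ := by
    refine (Filter.eventually_all_finite S.finite_rsp_ne_bot).2 fun α _ => ?_
    by_cases hα : 0 < α S.H₀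
    · filter_upwards [nhdsWithin_le_nhds (eventually_le_nhds hα)] with c hc _ using hc
    · exact Filter.Eventually.of_forall fun c h0 => absurd h0 hα
  obtain ⟨c, hc, hc0⟩ := (h.and self_mem_nhdsWithin).exists
  exact ⟨c, hc0, gradedSum_mono_of_ne_bot fun α hα h0 => hc α h0 hα⟩

/-- For regular `H`, every element of `H + 𝔫` is conjugate to `H` under the unipotent group. -/
lemma exists_conj {H : S.𝔞} (hH : H ∈ regularSet S.𝔤 S.𝔞) {X : S.𝔤} (hX : X ∈ S.nil) :
    ∃ u ∈ S.expNil, S.adEquiv u (S.incl H + X) = S.incl H := by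
  obtain ⟨C, hC⟩ := S.exists_forall_lt
  obtain ⟨c, hc, hnil⟩ := S.exists_nil_le_nilGE
  -- The depth doubles at each step; once it reaches `C`, above the value of every root at `H₀`,
  -- nothing is left.
  have key (k : ℕ) : ∀ c : ℝ, 0 < c → C ≤ 2 ^ k * c → ∀ X ∈ S.nilGE c,
      ∃ u ∈ S.expNil, S.adEquiv u (S.incl H + X) = S.incl H := by
    induction k with
    | zero =>
      intro c _ hCc X hX
      have h0 : S.nilGE c ≤ ⊥ := by
        refine gradedSum_le fun α hα => ?_
        by_contra hne
        rw [Set.mem_ofPred_eq] at hα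
        have := hC α fun h => hne h.le
        linarith
      rw [(Submodule.mem_bot ℝ).1 (h0 hX), add_zero]
      exact ⟨1, one_mem _, Subtype.ext (S.Ad_one _)⟩
    | succ k ih =>
      intro c hc hCc X hX
      obtain ⟨u, hu, X', hX', e⟩ := S.exists_conj_step hH hc hX
      obtain ⟨v, hv, e'⟩ := ih (2 * c) (by linarith) (by rw [pow_succ] at hCc; linarith) X' hX'
      exact ⟨v * u, mul_mem hv hu, by rw [adEquiv_mul, e, e']⟩
  obtain ⟨k, hk⟩ := pow_unbounded_of_one_lt (C / c) (one_lt_two (α := ℝ))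
  exact key k c hc ((div_lt_iff₀ hc).1 hk).le X (hnil hX)

/-! ### The Bruhat decomposition -/

/-- The nonzero root spaces lie in eigenspaces of `ad H` with nonzero eigenvalue, so the centralizer
of a regular element is 𝔞. -/
lemma mem_range_incl_of_lie_eq_zero {H : S.𝔞} (hH : H ∈ regularSet S.𝔤 S.𝔞) {X : S.𝔤}
    (hX : ⁅S.incl H, X⁆ = 0) : X ∈ LinearMap.range S.incl := by
  have htop : X ∈ gradedSum S.rsp ({0} ∪ {0}ᶜ) := by
    rw [Set.union_compl_self, gradedSum_rsp_univ]; exact Submodule.mem_top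
  rw [gradedSum_union, ← range_incl_eq] at htop
  obtain ⟨-, ⟨K, rfl⟩, Z, hZ, rfl⟩ := Submodule.mem_sup.1 htop
  rw [lie_add, incl_lie_incl, zero_add] at hX
  have hZ0 : Z ∈ Module.End.eigenspace (S.adA H) 0 := by
    rw [Module.End.mem_eigenspace_iff, adA_apply, hX, zero_smul]
  have hZ1 : Z ∈ gradedSum (Module.End.eigenspace (S.adA H)) {0}ᶜ := by
    refine gradedSum_le (fun α hα => ?_) hZ
    by_cases hb : S.rsp α = ⊥
    · rw [hb]; exact bot_le
    · exact le_trans (iInf_le _ H) (le_gradedSum (hH α (mem_roots_of_rsp_ne_bot hb hα)))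
  rw [← gradedSum_singleton (E := Module.End.eigenspace (S.adA H))] at hZ0
  have := (gradedSum_disjoint (Module.End.eigenspaces_iSupIndep (S.adA H))
    disjoint_compl_right).le_bot ⟨hZ0, hZ1⟩
  rw [(Submodule.mem_bot ℝ).1 this, add_zero]
  exact ⟨K, rfl⟩

lemma borel_inf_map_sup (g : G) :
    (S.borel ⊓ S.borel.map ((S.adEquiv g).toLinearEquiv : S.𝔤 →ₗ[ℝ] S.𝔤)) ⊔ S.nil = S.borel :=
  inf_map_sup_eq_of_isotropic S.killing S.killing_nondegenerate S.killing_comm S.orthogonal_nil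
    S.nil_le_borel (fun _ => S.mem_nil_of_isotropic) (S.adEquiv g).toLinearEquiv
    fun X Y => LieAlgebra.killingForm_of_equiv_apply (S.adEquiv g) X Y

/-- The elements of the Borel subalgebra whose semisimple part is annihilated by `α`. -/
def borelKer (α : Module.Dual ℝ S.𝔞) : Submodule ℝ S.𝔤 := (LinearMap.ker α).map S.incl ⊔ S.nil

/-- The intersection of 𝔞 and 𝔫 is zero, as the Killing form is positive definite on the former and
vanishes on the latter; so the 𝔞-component is well defined. -/
lemma not_borel_le_borelKer {α : Module.Dual ℝ S.𝔞} (h : α ≠ 0) : ¬S.borel ≤ S.borelKer α := by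
  intro hle
  refine h (LinearMap.ext fun H => ?_)
  obtain ⟨-, ⟨K, hK, rfl⟩, N, hN, e⟩ :=
    Submodule.mem_sup.1 (hle (Submodule.mem_sup_left ⟨H, rfl⟩ : S.incl H ∈ S.borel))
  have hN' : N = S.incl (H - K) := by rw [map_sub, ← e]; abel
  have h0 : H - K = 0 := by
    by_contra h0
    refine (S.killing_incl_pos h0).ne' ?_
    rw [← hN']
    exact S.killing_nil_nil hN hN
  rw [sub_eq_zero.1 h0]
  exact hK

/-- Since 𝔟 ∩ Ad_g 𝔟 surjects onto 𝔟/𝔫, no nonzero linear form on 𝔞 can vanish on all its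
𝔞-components. -/
lemma not_inf_le_borelKer {α : Module.Dual ℝ S.𝔞} (h : α ≠ 0) (g : G) :
    ¬S.borel ⊓ S.borel.map ((S.adEquiv g).toLinearEquiv : S.𝔤 →ₗ[ℝ] S.𝔤) ≤ S.borelKer α := by
  intro hle
  refine S.not_borel_le_borelKer h ?_
  rw [← S.borel_inf_map_sup g]
  exact sup_le hle le_sup_right

lemma mem_regularSet_of_notMem_borelKer {H : S.𝔞} {N : S.𝔤} (hN : N ∈ S.nil)
    (h : ∀ α ∈ roots S.𝔤 S.𝔞, S.incl H + N ∉ S.borelKer α) : H ∈ regularSet S.𝔤 S.𝔞 :=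
  fun α hα h0 => h α hα (add_mem (Submodule.mem_sup_left ⟨H, h0, rfl⟩) (Submodule.mem_sup_right hN))

/-- Two conjugate Borel subalgebras have a common element that is regular in both of them. -/
lemma exists_common_regular (g : G) : ∃ H ∈ regularSet S.𝔤 S.𝔞, ∃ H' ∈ regularSet S.𝔤 S.𝔞,
    ∃ N ∈ S.nil, ∃ N' ∈ S.nil, S.incl H + N = S.adEquiv g (S.incl H' + N') := by
  set b' := S.borel.map ((S.adEquiv g).toLinearEquiv : S.𝔤 →ₗ[ℝ] S.𝔤) with hb'
  set p := S.borel ⊓ b' with hp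
  let ψ : p →ₗ[ℝ] S.𝔤 := ((S.adEquiv g⁻¹).toLinearEquiv : S.𝔤 →ₗ[ℝ] S.𝔤) ∘ₗ p.subtype
  have : Finite (roots S.𝔤 S.𝔞) :=
    (S.finite_rsp_ne_bot.subset fun α hα => rsp_ne_bot_of_mem_roots hα).to_subtype
  let q : roots S.𝔤 S.𝔞 ⊕ roots S.𝔤 S.𝔞 → Subspace ℝ p :=
    Sum.elim (fun α => (S.borelKer α).comap p.subtype) fun α => (S.borelKer α).comap ψ
  -- A real vector space is not a finite union of proper subspaces. Here there are two per root, one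
  -- for regularity in each Borel subalgebra; they are proper by the previous lemma for `g` and for
  -- `g⁻¹`.
  obtain ⟨z, hz⟩ : ∃ z : p, ∀ i, z ∉ q i := by
    by_contra! hcon
    obtain ⟨i, hi⟩ := Subspace.exists_eq_top_of_iUnion_eq_univ (p := q)
      (Set.eq_univ_of_forall fun z => Set.mem_iUnion.2 (hcon z))
    rcases i with α | α
    · refine S.not_inf_le_borelKer α.2.1 g fun X hX => ?_
      have : (⟨X, hX⟩ : p) ∈ q (Sum.inl α) := by rw [hi]; exact Submodule.mem_top
      exact this
    · refine S.not_inf_le_borelKer α.2.1 g⁻¹ ?_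
      rintro X ⟨hX, Y, hY, hYX⟩
      have hXY : S.adEquiv g X = Y := by
        rw [← hYX]
        exact S.adEquiv_adEquiv_inv g Y
      have hmem : S.adEquiv g X ∈ p := ⟨by rw [hXY]; exact hY, ⟨X, hX, rfl⟩⟩
      have : (⟨_, hmem⟩ : p) ∈ q (Sum.inr α) := by rw [hi]; exact Submodule.mem_top
      have h2 : S.adEquiv g⁻¹ (S.adEquiv g X) ∈ S.borelKer α := this
      rwa [adEquiv_inv_adEquiv] at h2
  obtain ⟨z, hz1, Y, hY, rfl⟩ := z
  obtain ⟨-, ⟨H, rfl⟩, N, hN, hHN⟩ := Submodule.mem_sup.1 hz1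
  obtain ⟨-, ⟨H', rfl⟩, N', hN', rfl⟩ := Submodule.mem_sup.1 hY
  refine ⟨H, S.mem_regularSet_of_notMem_borelKer hN fun α hα => ?_, H',
    S.mem_regularSet_of_notMem_borelKer hN' fun α hα => ?_, N, hN, N', hN', hHN⟩
  · rw [hHN]
    exact hz (Sum.inl ⟨α, hα⟩)
  · rw [← S.adEquiv_inv_adEquiv g (S.incl H' + N')]
    exact hz (Sum.inr ⟨α, hα⟩)

/-- The Bruhat decomposition. -/
lemma exists_bruhat (g : G) : ∃ u ∈ S.expNil, ∃ v ∈ S.expNil, ∃ w : G, g = u * w * v ∧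
    ∀ K, S.adEquiv w (S.incl K) ∈ LinearMap.range S.incl := by
  obtain ⟨H, hH, H', hH', N, hN, N', hN', e⟩ := S.exists_common_regular g
  obtain ⟨u, hu, hu'⟩ := S.exists_conj hH hN
  obtain ⟨v, hv, hv'⟩ := S.exists_conj hH' hN'
  -- The middle factor `u g v⁻¹` sends the regular element `H'` to the regular element `H`, hence
  -- maps 𝔞 into the centralizer of `H`, which is 𝔞.
  refine ⟨u⁻¹, inv_mem hu, v, hv, u * g * v⁻¹, by group, fun K => ?_⟩
  refine S.mem_range_incl_of_lie_eq_zero hH ?_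
  have hw : S.adEquiv (u * g * v⁻¹) (S.incl H') = S.incl H := by
    rw [adEquiv_mul, adEquiv_mul, ← hv', adEquiv_inv_adEquiv, ← e, hu']
  rw [← hw, ← LieEquiv.map_lie, incl_lie_incl, map_zero]

end NonSwingingRep

namespace NonSwingingRep

variable (S : NonSwingingRep G V) [FiniteDimensional ℝ V] [CompleteSpace V]

/-! ### The decomposition `V = V⁺ ⊕ V⁰ ⊕ V⁻` -/

lemma Vpos_eq : S.Vpos = eigenSum S.X₀ (Set.Ioi 0) := by
  rw [← gradedSum_weightSpace_eq]
  exact le_antisymm (gradedSum_mono fun μ h => h.2) (gradedSum_mono_of_ne_bot fun μ h h0 => ⟨h0, h⟩)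

lemma Vneg_eq : S.Vneg = eigenSum S.X₀ (Set.Iio 0) := by
  rw [← gradedSum_weightSpace_eq]
  exact le_antisymm (gradedSum_mono fun μ h => h.2) (gradedSum_mono_of_ne_bot fun μ h h0 => ⟨h0, h⟩)

lemma Vpos0_eq : S.Vpos0 = eigenSum S.X₀ (Set.Ici 0) := by
  rw [← gradedSum_weightSpace_eq]
  exact le_antisymm (gradedSum_mono fun μ h => h.2) (gradedSum_mono_of_ne_bot fun μ h h0 => ⟨h0, h⟩)

lemma Vneg0_eq : S.Vneg0 = eigenSum S.X₀ (Set.Iic 0) := by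
  rw [← gradedSum_weightSpace_eq]
  exact le_antisymm (gradedSum_mono fun μ h => h.2) (gradedSum_mono_of_ne_bot fun μ h h0 => ⟨h0, h⟩)

lemma Vzero_eq : S.Vzero = eigenSum S.X₀ {0} := by
  rw [Vzero, Vpos0_eq, Vneg0_eq, eigenSum_inf, Set.Ici_inter_Iic, Set.Icc_self]

lemma eigenSum_univ (X : S.𝔞) : eigenSum (X : V →L[ℝ] V) Set.univ = ⊤ := by
  rw [← gradedSum_weightSpace_eq, ← S.gradedSum_weightSpace_univ]
  simp

lemma Vpos_sup_Vneg : S.Vpos ⊔ S.Vneg = eigenSum S.X₀ {0}ᶜ := by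
  rw [Vpos_eq, Vneg_eq, eigenSum_sup, Set.union_comm, Set.Iio_union_Ioi]

lemma isCompl_Vzero : IsCompl S.Vzero (S.Vpos ⊔ S.Vneg) := by
  rw [Vzero_eq, Vpos_sup_Vneg]
  refine ⟨eigenSum_disjoint _ disjoint_compl_right, codisjoint_iff.2 ?_⟩
  rw [eigenSum_sup, Set.union_compl_self, eigenSum_univ]

lemma Vpos_sup_Vzero : S.Vpos ⊔ S.Vzero = S.Vpos0 := by
  rw [Vpos_eq, Vzero_eq, Vpos0_eq, eigenSum_sup]
  congr 1
  ext x
  simp [le_iff_lt_or_eq, eq_comm, or_comm]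

lemma Vneg_sup_Vzero : S.Vneg ⊔ S.Vzero = S.Vneg0 := by
  rw [Vneg_eq, Vzero_eq, Vneg0_eq, eigenSum_sup]
  congr 1
  ext x
  simp [le_iff_lt_or_eq, or_comm]

lemma isCompl_Vpos_Vneg0 : IsCompl S.Vpos S.Vneg0 := by
  rw [Vpos_eq, Vneg0_eq, ← Set.compl_Iic]
  refine ⟨eigenSum_disjoint _ disjoint_compl_left, codisjoint_iff.2 ?_⟩
  rw [eigenSum_sup, Set.compl_union_self, eigenSum_univ]

/-- Genericity: 0 is the only weight that vanishes at `X₀`. -/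
lemma Vzero_eq_weightSpace : S.Vzero = weightSpace S.𝔞 0 := by
  rw [Vzero_eq, ← gradedSum_weightSpace_eq, ← gradedSum_singleton (E := weightSpace S.𝔞) 0]
  apply le_antisymm
  · refine gradedSum_mono_of_ne_bot fun μ h h0 => ?_
    have h : μ S.X₀ = 0 := h
    exact S.generic ⟨⟨h0, h.ge⟩, ⟨h0, h.le⟩⟩
  · refine gradedSum_mono fun μ h => ?_
    rw [Set.mem_singleton_iff] at h
    rw [h]
    exact LinearMap.zero_apply _

/-! ### Stabilizers -/

lemma translate_w₀_eigenSum (s : Set ℝ) :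
    S.translate S.w₀ (eigenSum S.X₀ s) = eigenSum S.X₀ (-s) := by
  have h : -(S.X₀ : V →L[ℝ] V) = Ad S.R S.w₀ S.X₀ := S.symmetric
  rw [translate_eigenSum, ← eigenSum_neg, h]

lemma translate_w₀_Vpos0 : S.translate S.w₀ S.Vpos0 = S.Vneg0 := by
  rw [Vpos0_eq, Vneg0_eq, translate_w₀_eigenSum, Set.neg_Ici, neg_zero]

lemma translate_w₀_Vneg0 : S.translate S.w₀ S.Vneg0 = S.Vpos0 := by
  rw [Vpos0_eq, Vneg0_eq, translate_w₀_eigenSum, Set.neg_Iic, neg_zero]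

lemma translate_w₀_Vpos : S.translate S.w₀ S.Vpos = S.Vneg := by
  rw [Vpos_eq, Vneg_eq, translate_w₀_eigenSum, Set.neg_Ioi, neg_zero]

lemma translate_w₀_Vneg : S.translate S.w₀ S.Vneg = S.Vpos := by
  rw [Vpos_eq, Vneg_eq, translate_w₀_eigenSum, Set.neg_Iio, neg_zero]

lemma translate_w₀_Vzero : S.translate S.w₀ S.Vzero = S.Vzero := by
  rw [Vzero_eq, translate_w₀_eigenSum, Set.neg_singleton, neg_zero]

/-- Positive roots are nonnegative at `X₀`, so positive root vectors never lower the value of a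
weight at `X₀`. -/
lemma translate_expNil {u : G} (hu : u ∈ S.expNil) {s : Set ℝ} (hs : IsUpperSet s) :
    S.translate u (eigenSum S.X₀ s) = eigenSum S.X₀ s := by
  refine S.translate_eq_of_mem_closure
    (s := {g | ∃ Y ∈ S.nil, S.R g = NormedSpace.exp (Y : V →L[ℝ] V)}) ?_ hu
  rintro g ⟨Y, hY, hg⟩
  refine S.translate_eq_of_exp hg fun v hv => ?_
  rw [← gradedSum_weightSpace_eq] at hv ⊢
  refine S.apply_mem_gradedSum (fun α hα h0 μ hμ => ?_) hY hv
  rw [Set.mem_ofPred_eq] at hα hμ ⊢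
  refine hs ?_ hμ
  rw [LinearMap.add_apply]
  linarith [S.nonneg_X₀ h0 hα]

lemma translate_expNil_Vpos0 {u : G} (hu : u ∈ S.expNil) :
    S.translate u S.Vpos0 = S.Vpos0 := by
  rw [Vpos0_eq, S.translate_expNil hu (isUpperSet_Ici 0)]

lemma translate_expNil_Vpos {u : G} (hu : u ∈ S.expNil) : S.translate u S.Vpos = S.Vpos := by
  rw [Vpos_eq, S.translate_expNil hu (isUpperSet_Ioi 0)]

section Normalizer

variable {S} {w : G} {Y : S.𝔞}

lemma translate_normalizer (hY : S.incl Y = S.adEquiv w (S.incl S.X₀)) (s : Set ℝ) :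
    S.translate w (eigenSum S.X₀ s) = eigenSum Y s := by
  have h : (Y : V →L[ℝ] V) = Ad S.R w S.X₀ := congrArg Subtype.val hY
  rw [translate_eigenSum, h]

/-- The zero weight vanishes at `Y = w X₀`, which gives one inclusion; `w` carries the kernel of
`X₀` to that of `Y`, so the dimensions agree. -/
lemma eigenSum_zero_normalizer (hY : S.incl Y = S.adEquiv w (S.incl S.X₀)) :
    eigenSum (Y : V →L[ℝ] V) {0} = S.Vzero := by
  refine (Submodule.eq_of_le_of_finrank_eq ?_ ?_).symm
  · rw [Vzero_eq_weightSpace, ← gradedSum_weightSpace_eq]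
    exact le_gradedSum (LinearMap.zero_apply _)
  · rw [← translate_normalizer hY, finrank_translate, Vzero_eq]

lemma eq_zero_of_normalizer (hY : S.incl Y = S.adEquiv w (S.incl S.X₀))
    {μ : Module.Dual ℝ S.𝔞} (h0 : weightSpace S.𝔞 μ ≠ ⊥) (h : μ Y = 0) :
    μ = 0 := by
  by_contra hμ
  have h1 : weightSpace S.𝔞 μ ≤ weightSpace S.𝔞 0 := by
    rw [← Vzero_eq_weightSpace, ← eigenSum_zero_normalizer hY, ← gradedSum_weightSpace_eq]
    exact le_gradedSum h
  exact h0 (disjoint_self.1 ((S.iSupIndep_weightSpace.pairwiseDisjoint hμ).mono_right h1))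

/-- A weight positive at `Y = w X₀` has its weight space in w V^{+,0} = V^{+,0}, so it is
nonnegative at `X₀`; genericity excludes the value zero. Equality follows by dimension. -/
lemma translate_normalizer_Vpos (hY : S.incl Y = S.adEquiv w (S.incl S.X₀))
    (h : S.translate w S.Vpos0 = S.Vpos0) :
    S.translate w S.Vpos = S.Vpos := by
  have hle : S.translate w S.Vpos ≤ S.Vpos := by
    rw [Vpos_eq, translate_normalizer hY, ← gradedSum_weightSpace_eq, ← gradedSum_weightSpace_eq]
    refine gradedSum_mono_of_ne_bot fun μ hμ h0 => ?_
    have hμ : 0 < μ Y := hμ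
    change 0 < μ S.X₀
    by_contra hneg
    rcases (not_lt.1 hneg).lt_or_eq with hlt | heq
    · refine h0 (disjoint_self.1 ?_)
      have h1 : weightSpace S.𝔞 μ ≤ eigenSum S.X₀ (Set.Iio 0) := by
        rw [← gradedSum_weightSpace_eq]; exact le_gradedSum hlt
      have h2 : weightSpace S.𝔞 μ ≤ eigenSum S.X₀ (Set.Ici 0) := by
        rw [← Vpos0_eq, ← h, Vpos0_eq, translate_normalizer hY, ← gradedSum_weightSpace_eq]
        exact le_gradedSum hμ.le
      exact (eigenSum_disjoint _ (Set.Iio_disjoint_Ici le_rfl)).mono h1 h2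
    · have : μ = 0 := S.generic ⟨⟨h0, heq.ge⟩, ⟨h0, heq.le⟩⟩
      rw [this, LinearMap.zero_apply] at hμ
      exact lt_irrefl _ hμ
  exact Submodule.eq_of_le_of_finrank_eq hle (S.finrank_translate _ _)

/-- Transversality says that every weight is nonnegative at `X₀` or at `Y`. One that is negative at
`X₀` is thus nonnegative, hence positive, at `Y`, so V⁻ ⊆ w V⁺; the dimensions agree because `w₀`
exchanges V⁺ and V⁻. -/
lemma translate_normalizer_Vpos0 (hY : S.incl Y = S.adEquiv w (S.incl S.X₀))
    (h : S.translate w S.Vpos0 ⊔ S.Vpos0 = ⊤) :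
    S.translate w S.Vpos0 = S.Vneg0 := by
  have hle : S.Vneg ≤ S.translate w S.Vpos := by
    rw [Vpos_eq, Vneg_eq, translate_normalizer hY, ← gradedSum_weightSpace_eq,
      ← gradedSum_weightSpace_eq]
    refine gradedSum_mono_of_ne_bot fun μ hμ h0 => ?_
    have hμ : μ S.X₀ < 0 := hμ
    change 0 < μ Y
    by_contra hneg
    rcases (not_lt.1 hneg).lt_or_eq with hlt | heq
    · rw [Vpos0_eq, translate_normalizer hY, ← gradedSum_weightSpace_eq,
        ← gradedSum_weightSpace_eq, ← gradedSum_union] at h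
      have hd := gradedSum_disjoint S.iSupIndep_weightSpace (s := {μ})
        (t := {μ : Module.Dual ℝ S.𝔞 | μ Y ∈ Set.Ici 0} ∪ {μ | μ S.X₀ ∈ Set.Ici 0}) (by
          rw [Set.disjoint_singleton_left]
          rintro (h | h)
          · exact hlt.not_ge h
          · exact hμ.not_ge h)
      rw [h, gradedSum_singleton, disjoint_top] at hd
      exact h0 hd
    · rw [eq_zero_of_normalizer hY h0 heq, LinearMap.zero_apply] at hμ
      exact lt_irrefl _ hμ
  have heq : S.Vneg = S.translate w S.Vpos := by
    refine Submodule.eq_of_le_of_finrank_eq hle ?_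
    rw [finrank_translate, ← translate_w₀_Vpos, finrank_translate]
  have hz : S.translate w S.Vzero = S.Vzero := by
    conv_lhs => rw [Vzero_eq, translate_normalizer hY, eigenSum_zero_normalizer hY]
  rw [← Vpos_sup_Vzero, translate_sup, ← heq, hz, Vneg_sup_Vzero]

end Normalizer

/-- The stabilizer of `V^{+,0}` preserves `V⁺`. -/
lemma translate_Vpos_of_translate_Vpos0 {g : G} (h : S.translate g S.Vpos0 = S.Vpos0) :
    S.translate g S.Vpos = S.Vpos := by
  obtain ⟨u, hu, v, hv, w, rfl, hw⟩ := S.exists_bruhat g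
  obtain ⟨Y, hY⟩ := hw S.X₀
  rw [translate_mul, translate_mul, S.translate_expNil_Vpos0 hv] at h
  rw [translate_mul, translate_mul, S.translate_expNil_Vpos hv,
    translate_normalizer_Vpos hY, S.translate_expNil_Vpos hu]
  apply S.translate_injective u
  rw [h, S.translate_expNil_Vpos0 hu]

/-- The stabilizer of `V^{-,0}` preserves `V⁻`. -/
lemma translate_Vneg_of_translate_Vneg0 {g : G} (h : S.translate g S.Vneg0 = S.Vneg0) :
    S.translate g S.Vneg = S.Vneg := by
  have h1 : S.translate (S.w₀⁻¹ * g * S.w₀) S.Vpos = S.Vpos := by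
    apply translate_Vpos_of_translate_Vpos0
    rw [translate_mul, translate_mul, translate_w₀_Vpos0, h, ← translate_w₀_Vpos0,
      translate_inv_translate]
  rw [translate_mul, translate_mul, translate_w₀_Vpos] at h1
  rw [← S.translate_translate_inv S.w₀ (S.translate g S.Vneg), h1, translate_w₀_Vpos]

/-- Transverse parabolic spaces have a frame. -/
lemma exists_isFrame {W₁ W₂ : Submodule ℝ V} (h₁ : S.IsParabolic W₁) (h₂ : S.IsParabolic W₂)
    (h : W₁ ⊔ W₂ = ⊤) : ∃ k, S.IsFrame k W₁ W₂ := by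
  obtain ⟨g₁, rfl⟩ := h₁
  obtain ⟨g₂, rfl⟩ := h₂
  obtain ⟨u, hu, v, hv, w, hg, hw⟩ := S.exists_bruhat (g₁⁻¹ * g₂)
  obtain ⟨Y, hY⟩ := hw S.X₀
  have hg₂ : g₂ = g₁ * u * w * v := by
    rw [mul_assoc, mul_assoc, ← mul_assoc u, ← hg, mul_inv_cancel_left]
  have e₁ : S.translate g₁ S.Vpos0 = S.translate (g₁ * u) S.Vpos0 := by
    rw [translate_mul, S.translate_expNil_Vpos0 hu]
  have e₂ : S.translate g₂ S.Vpos0 = S.translate (g₁ * u) (S.translate w S.Vpos0) := by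
    rw [hg₂, translate_mul, translate_mul, S.translate_expNil_Vpos0 hv]
  -- Both unipotent factors fix V^{+,0}, so after translation by `g₁ u` the pair is V^{+,0} and `w`
  -- V^{+,0}.
  refine ⟨g₁ * u, e₁, ?_⟩
  rw [e₂, translate_normalizer_Vpos0 hY]
  rw [e₁, e₂, ← translate_sup] at h
  apply S.translate_injective (g₁ * u)
  rw [translate_top, sup_comm, h]

end NonSwingingRep

/-! ### Polynomial functions -/

lemma det_mem_polynomialFunctions {n : Type*} [Fintype n] [DecidableEq n]
    {M : (V →L[ℝ] V) → Matrix n n ℝ}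
    (h : ∀ i j, (fun T => M T i j) ∈ polynomialFunctions V) :
    (fun T => (M T).det) ∈ polynomialFunctions V := by
  have : (fun T => (M T).det)
      = ∑ σ : Equiv.Perm n, ((σ.sign : ℤ) : ℤ) • ∏ i, fun T => M T (σ i) i := by
    funext T
    rw [Matrix.det_apply, Finset.sum_apply]
    refine Finset.sum_congr rfl fun σ _ => ?_
    rw [Pi.smul_apply, Finset.prod_apply, Units.smul_def]
  rw [this]
  exact sum_mem fun σ _ => zsmul_mem (prod_mem fun i _ => h _ _) _

lemma analyticOnNhd_of_mem_polynomialFunctions [FiniteDimensional ℝ V] {f : (V →L[ℝ] V) → ℝ}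
    (hf : f ∈ polynomialFunctions V) : AnalyticOnNhd ℝ f Set.univ := by
  induction hf using Algebra.adjoin_induction with
  | mem f hf =>
    obtain ⟨φ, rfl⟩ := hf
    exact (LinearMap.toContinuousLinearMap φ).analyticOnNhd _
  | algebraMap c => exact analyticOnNhd_const
  | add f g _ _ hf hg => exact hf.add hg
  | mul f g _ _ hf hg => exact hf.mul hg

/-! ### Minors and Schur complements -/

section Schur

variable {P N : Submodule ℝ V} (hPN : IsCompl P N)

/-- The `P`-block of an endomorphism of `V = P ⊕ N`. -/
def block : (V →L[ℝ] V) →ₗ[ℝ] Module.End ℝ P where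
  toFun T := P.projectionOnto N hPN ∘ₗ (T : V →ₗ[ℝ] V) ∘ₗ P.subtype
  map_add' T T' := by ext; simp
  map_smul' c T := by ext; simp

lemma block_apply (T : V →L[ℝ] V) (y : P) : block hPN T y = P.projectionOnto N hPN (T y) := rfl

lemma block_one : block hPN (1 : V →L[ℝ] V) = 1 := by
  ext y
  simp [block_apply]

variable [FiniteDimensional ℝ V]

/-- The matrix of the `P`-block of `T`, bordered by a vector `v` and a linear form `φ`. -/
def borderedMatrix (φ : Module.Dual ℝ V) (v : V) (T : V →L[ℝ] V) :
    Matrix (Fin (Module.finrank ℝ P) ⊕ Unit) (Fin (Module.finrank ℝ P) ⊕ Unit) ℝ :=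
  Matrix.fromBlocks (LinearMap.toMatrix (Module.finBasis ℝ P) (Module.finBasis ℝ P) (block hPN T))
    (Matrix.of fun i _ => (Module.finBasis ℝ P).repr (P.projectionOnto N hPN (T v)) i)
    (Matrix.of fun _ j => φ (T (Module.finBasis ℝ P j)))
    (Matrix.of fun _ _ => φ (T v))

/-- This is the Schur complement formula: subtracting from the last column the combination of the
others given by `y` clears its `P`-part and leaves `φ (T (v - y))` in the corner. -/
lemma det_borderedMatrix {φ : Module.Dual ℝ V} {v : V} {T : V →L[ℝ] V} {y : P}
    (h : T (v - y) ∈ N) :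
    (borderedMatrix hPN φ v T).det = LinearMap.det (block hPN T) * φ (T (v - y)) := by
  set b := Module.finBasis ℝ P with hb
  have hy : P.projectionOnto N hPN (T v) = block hPN T y := by
    rw [← Submodule.projectionOnto_apply_eq_zero_iff hPN, map_sub, map_sub, sub_eq_zero] at h
    exact h
  let U : Matrix (Fin (Module.finrank ℝ P) ⊕ Unit) (Fin (Module.finrank ℝ P) ⊕ Unit) ℝ :=
    Matrix.fromBlocks 1 (Matrix.of fun i _ => -(b.repr y i)) 0 1
  have hU : U.det = 1 := by simp [U]
  have hmul : borderedMatrix hPN φ v T * U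
      = Matrix.fromBlocks (LinearMap.toMatrix b b (block hPN T)) 0
        (Matrix.of fun _ j => φ (T (b j))) (Matrix.of fun _ _ => φ (T (v - y))) := by
    rw [borderedMatrix, Matrix.fromBlocks_multiply]
    congr 1
    · simp [hb]
    · ext i j
      have := congrFun (LinearMap.toMatrix_mulVec_repr b b (block hPN T) y) i
      rw [← hy] at this
      simp [Matrix.mul_apply, ← hb, ← this, Matrix.mulVec, dotProduct]
    · simp
      rfl
    · ext i j
      have := congrArg (fun z : P => φ (T z)) (b.sum_repr y)
      simp only [map_sum, Submodule.coe_sum, Submodule.coe_smul, map_smul, smul_eq_mul] at this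
      simp [Matrix.mul_apply, ← this, mul_comm, sub_eq_neg_add]
      rfl
  have hdet := congrArg Matrix.det hmul
  rw [Matrix.det_mul, hU, mul_one, Matrix.det_fromBlocks_zero₁₂, LinearMap.det_toMatrix] at hdet
  rw [hdet, Matrix.det_unique]
  rfl

lemma det_block_mem_polynomialFunctions :
    (fun T => LinearMap.det (block hPN T)) ∈ polynomialFunctions V := by
  have : (fun T => LinearMap.det (block hPN T)) = fun T =>
      (LinearMap.toMatrix (Module.finBasis ℝ P) (Module.finBasis ℝ P) (block hPN T)).det := by
    funext T
    rw [LinearMap.det_toMatrix]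
  rw [this]
  refine det_mem_polynomialFunctions fun i j => ?_
  exact linear_mem_polynomialFunctions (LinearMap.proj j ∘ₗ LinearMap.proj i ∘ₗ
    (LinearMap.toMatrix (Module.finBasis ℝ P) (Module.finBasis ℝ P)).toLinearMap ∘ₗ block hPN)

lemma det_borderedMatrix_mem_polynomialFunctions (φ : Module.Dual ℝ V) (v : V) :
    (fun T => (borderedMatrix hPN φ v T).det) ∈ polynomialFunctions V := by
  have hev (v : V) : ∃ e : (V →L[ℝ] V) →ₗ[ℝ] V, ∀ T, e T = T v :=
    ⟨(ContinuousLinearMap.apply ℝ V v : (V →L[ℝ] V) →ₗ[ℝ] V), fun T => rfl⟩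
  refine det_mem_polynomialFunctions fun i j => ?_
  rcases i with i | i <;> rcases j with j | j
  · exact linear_mem_polynomialFunctions (LinearMap.proj j ∘ₗ LinearMap.proj i ∘ₗ
      (LinearMap.toMatrix (Module.finBasis ℝ P) (Module.finBasis ℝ P)).toLinearMap ∘ₗ block hPN)
  · obtain ⟨e, he⟩ := hev v
    convert linear_mem_polynomialFunctions
      ((Module.finBasis ℝ P).coord i ∘ₗ P.projectionOnto N hPN ∘ₗ e) using 2 with T
    simp [borderedMatrix, he]
  · obtain ⟨e, he⟩ := hev (Module.finBasis ℝ P j : V)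
    convert linear_mem_polynomialFunctions (φ ∘ₗ e) using 2 with T
    simp [borderedMatrix, he]
  · obtain ⟨e, he⟩ := hev v
    convert linear_mem_polynomialFunctions (φ ∘ₗ e) using 2 with T
    simp [borderedMatrix, he]

end Schur

namespace NonSwingingRep

variable (S : NonSwingingRep G V) [FiniteDimensional ℝ V] [CompleteSpace V]

/-! ### Analytic paths in the identity component -/

/-- Products of `exp (t X)` join 1 to any element of the identity component. Analyticity is for the
identity theorem, and the form `Z γ` of the derivative ties the path to the Lie algebra. -/
lemma exists_analytic_path {g : G} (hg : g ∈ identityComponent S.R S.𝔤) :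
    ∃ γ : ℝ → V →L[ℝ] V, AnalyticOnNhd ℝ γ Set.univ ∧ γ 0 = 1 ∧ γ 1 = S.R g ∧
      ∀ t, γ t ∈ Set.range S.R ∧ ∃ Z ∈ S.𝔤, HasDerivAt γ (Z * γ t) t := by
  have step (X : V →L[ℝ] V) (hX : X ∈ S.𝔤) (x y : G) (hx : S.R x = NormedSpace.exp X)
      (hy : ∃ γ : ℝ → V →L[ℝ] V, AnalyticOnNhd ℝ γ Set.univ ∧ γ 0 = 1 ∧ γ 1 = S.R y ∧
        ∀ t, γ t ∈ Set.range S.R ∧ ∃ Z ∈ S.𝔤, HasDerivAt γ (Z * γ t) t) :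
      ∃ γ : ℝ → V →L[ℝ] V, AnalyticOnNhd ℝ γ Set.univ ∧ γ 0 = 1 ∧ γ 1 = S.R (x * y) ∧
        ∀ t, γ t ∈ Set.range S.R ∧ ∃ Z ∈ S.𝔤, HasDerivAt γ (Z * γ t) t := by
    obtain ⟨γ, hγ, h0, h1, hd⟩ := hy
    refine ⟨fun t => NormedSpace.exp (t • X) * γ t, ?_, ?_, ?_, fun t => ?_⟩
    · refine AnalyticOnNhd.mul (fun t _ => ?_) hγ
      exact (NormedSpace.exp_analytic (𝕂 := ℝ) (t • X)).comp
        (f := fun t : ℝ => t • X) (analyticAt_id.smul analyticAt_const)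
    · simp [h0, NormedSpace.exp_zero]
    · simp [h1, hx]
    · obtain ⟨⟨y', hy'⟩, Z, hZ, hZd⟩ := hd t
      obtain ⟨k, hk⟩ := (S.isLieAlgebra X).1 hX t
      -- The product rule gives `X` plus the old velocity conjugated by `k = exp (t X)`.
      refine ⟨⟨k * y', by rw [map_mul, hk, hy']⟩, X + Ad S.R k Z, add_mem hX (S.Ad_mem k hZ), ?_⟩
      have e : (X + Ad S.R k Z) * (NormedSpace.exp (t • X) * γ t)
          = X * NormedSpace.exp (t • X) * γ t + NormedSpace.exp (t • X) * (Z * γ t) := by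
        rw [← hk, add_mul, ← mul_assoc, Ad]
        congr 1
        rw [mul_assoc (S.R k * Z), ← mul_assoc (S.R k⁻¹), S.R_inv_mul_R, one_mul, mul_assoc]
      have hd := (hasDerivAt_exp_smul_const' X t).mul hZd
      rw [← e] at hd
      exact hd
  induction hg using Subgroup.closure_induction_left with
  | one => exact ⟨fun _ => 1, analyticOnNhd_const, rfl, by rw [map_one], fun t =>
      ⟨⟨1, map_one _⟩, 0, zero_mem _, by rw [zero_mul]; exact hasDerivAt_const _ _⟩⟩
  | mul_left x hx y _ ih =>
    obtain ⟨X, hX, hx⟩ := hx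
    exact step X hX x y hx ih
  | inv_mul_cancel x hx y _ ih =>
    obtain ⟨X, hX, hx⟩ := hx
    exact step (-X) (neg_mem hX) x⁻¹ y (S.R_inv_eq_exp_neg hx) ih

/-! ### The projection `π₀` -/

lemma proj0_apply (v : V) :
    S.proj0 v = S.Vzero.projectionOnto (S.Vpos ⊔ S.Vneg) S.isCompl_Vzero v := by
  rw [proj0, dif_pos S.isCompl_Vzero]
  rfl

lemma proj0_mem (v : V) : S.proj0 v ∈ S.Vzero := by
  rw [proj0_apply]
  exact Subtype.coe_prop _

lemma proj0_of_mem_Vzero {v : V} (h : v ∈ S.Vzero) : S.proj0 v = v := by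
  rw [proj0_apply, Submodule.projectionOnto_apply_of_mem_left _ h]

lemma proj0_eq_zero {v : V} (h : v ∈ S.Vpos ⊔ S.Vneg) : S.proj0 v = 0 := by
  rw [proj0_apply, (Submodule.projectionOnto_apply_eq_zero_iff _).2 h]
  rfl

lemma proj0_of_mem_Vpos {v : V} (h : v ∈ S.Vpos) : S.proj0 v = 0 :=
  S.proj0_eq_zero (Submodule.mem_sup_left h)

lemma proj0_of_mem_Vneg {v : V} (h : v ∈ S.Vneg) : S.proj0 v = 0 :=
  S.proj0_eq_zero (Submodule.mem_sup_right h)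

lemma sub_proj0_mem_Vneg {v : V} (h : v ∈ S.Vneg0) : v - S.proj0 v ∈ S.Vneg := by
  rw [← Vneg_sup_Vzero] at h
  obtain ⟨x, hx, y, hy, rfl⟩ := Submodule.mem_sup.1 h
  rw [map_add, S.proj0_of_mem_Vneg hx, S.proj0_of_mem_Vzero hy]
  simpa

lemma sub_proj0_mem_Vpos {v : V} (h : v ∈ S.Vpos0) : v - S.proj0 v ∈ S.Vpos := by
  rw [← Vpos_sup_Vzero] at h
  obtain ⟨x, hx, y, hy, rfl⟩ := Submodule.mem_sup.1 h
  rw [map_add, S.proj0_of_mem_Vpos hx, S.proj0_of_mem_Vzero hy]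
  simpa

lemma Vzero_le_Vpos0 : S.Vzero ≤ S.Vpos0 := inf_le_left

lemma Vzero_le_Vneg0 : S.Vzero ≤ S.Vneg0 := inf_le_right

lemma Vpos_le_Vpos0 : S.Vpos ≤ S.Vpos0 := by
  rw [← Vpos_sup_Vzero]; exact le_sup_left

/-- The Lie algebra acts by zero on the neutral block. -/
lemma proj0_lie_apply {X : V →L[ℝ] V} (hX : X ∈ S.𝔤) {v : V} (hv : v ∈ S.Vzero) :
    S.proj0 (X v) = 0 := by
  have hsub : gradedSum (weightSpace S.𝔞) {0}ᶜ ≤ S.Vpos ⊔ S.Vneg := by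
    rw [Vpos_sup_Vneg, ← gradedSum_weightSpace_eq]
    refine gradedSum_mono_of_ne_bot fun μ hμ h0 => ?_
    change μ S.X₀ ≠ 0
    exact fun h => hμ (S.generic ⟨⟨h0, h.ge⟩, ⟨h0, h.le⟩⟩)
  have htop : (⟨X, hX⟩ : S.𝔤) ∈ gradedSum S.rsp ({0} ∪ {0}ᶜ) := by
    rw [Set.union_compl_self, gradedSum_rsp_univ]; exact Submodule.mem_top
  rw [gradedSum_union, ← range_incl_eq] at htop
  -- By splitness `X` is an element of 𝔞, which kills the zero weight space, plus root vectors,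
  -- which move weight 0 to nonzero weights, that is, into V⁺ ⊕ V⁻.
  obtain ⟨-, ⟨K, rfl⟩, Z, hZ, e⟩ := Submodule.mem_sup.1 htop
  have e' : X = (K : V →L[ℝ] V) + Z := (congrArg Subtype.val e).symm
  rw [Vzero_eq_weightSpace] at hv
  have hK : (K : V →L[ℝ] V) v = 0 := by
    rw [hv K, LinearMap.zero_apply, zero_smul]
  rw [e', add_apply, hK, zero_add]
  refine S.proj0_eq_zero (hsub (S.apply_mem_gradedSum (t := {0}) ?_ hZ ?_))
  · intro α hα _ μ hμ
    rw [Set.mem_singleton_iff] at hμ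
    rwa [hμ, zero_add]
  · rwa [gradedSum_singleton]

end NonSwingingRep

/-! ### Constancy of the Schur complement and the trivial action on V^{+,0}/V⁺ -/

/-- Along a path through the identity, the equation `B(t) (v - y) ∈ N` has a differentiable solution
`y` in a complement of `N`. -/
lemma exists_differentiable_solution [FiniteDimensional ℝ V] {P N : Submodule ℝ V}
    (hPN : IsCompl P N) {B : ℝ → V →L[ℝ] V} {t₀ : ℝ} {Y : V →L[ℝ] V} (h1 : B t₀ = 1)
    (hB : HasDerivAt B Y t₀) {v : V} (hv : v ∈ N) :
    ∃ y : ℝ → P, y t₀ = 0 ∧ DifferentiableAt ℝ y t₀ ∧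
      ∀ᶠ t in nhds t₀, B t (v - y t) ∈ N := by
  have := FiniteDimensional.complete ℝ P
  let π : V →L[ℝ] P := LinearMap.toContinuousLinearMap (P.projectionOnto N hPN)
  let bl : (V →L[ℝ] V) →L[ℝ] (P →L[ℝ] P) := LinearMap.toContinuousLinearMap
    ((LinearMap.toContinuousLinearMap : (P →ₗ[ℝ] P) ≃ₗ[ℝ] (P →L[ℝ] P)).toLinearMap ∘ₗ block hPN)
  have hbl (T : V →L[ℝ] V) (y : P) : bl T y = P.projectionOnto N hPN (T y) := rfl
  have hbl1 : bl (B t₀) = 1 := by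
    ext y
    rw [hbl, h1]
    simp
  have hdiff : DifferentiableAt ℝ (fun t => bl (B t)) t₀ :=
    DifferentiableAt.comp (E := ℝ) (F := V →L[ℝ] V) (G := P →L[ℝ] P) t₀
      (g := fun T => bl T) (ContinuousLinearMap.differentiableAt (E := V →L[ℝ] V)
        (F := P →L[ℝ] P) bl) hB.differentiableAt
  have hunit : ∀ᶠ t in nhds t₀, IsUnit (bl (B t)) := by
    have hu : IsUnit (bl (B t₀)) := by rw [hbl1]; exact isUnit_one
    have hnhds : {x : P →L[ℝ] P | IsUnit x} ∈ nhds (bl (B t₀)) :=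
      IsOpen.mem_nhds (Units.isOpen (R := P →L[ℝ] P)) hu
    exact hdiff.continuousAt hnhds
  -- Solve the `P`-component of the equation by inverting the `P`-block of `B t`. `Ring.inverse` is
  -- zero at non-units, which is harmless since the block is invertible near `t₀`.
  refine ⟨fun t => Ring.inverse (bl (B t)) (π (B t v)), ?_, ?_, ?_⟩
  · have : π (B t₀ v) = 0 := by
      rw [h1]
      exact (Submodule.projectionOnto_apply_eq_zero_iff hPN).2 hv
    simp only [this, map_zero]
  · refine DifferentiableAt.clm_apply ?_ ?_
    · refine DifferentiableAt.comp t₀ (g := Ring.inverse) ?_ hdiff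
      exact differentiableAt_inverse (by rw [hbl1]; exact isUnit_one)
    · exact π.differentiableAt.comp t₀
        (hB.differentiableAt.clm_apply (differentiableAt_const v))
  · filter_upwards [hunit] with t ht
    rw [← Submodule.projectionOnto_apply_eq_zero_iff hPN, map_sub, map_sub, sub_eq_zero, ← hbl]
    have := congrArg (fun T : P →L[ℝ] P => T (π (B t v))) (Ring.mul_inverse_cancel _ ht)
    exact this.symm

namespace NonSwingingRep

variable (S : NonSwingingRep G V) [FiniteDimensional ℝ V] [CompleteSpace V]

/-- An element of the big cell is a product of elements of the opposite parabolic groups. -/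
lemma exists_eq_mul_of_det_block_ne_zero {g : G}
    (hg : LinearMap.det (block S.isCompl_Vpos_Vneg0 (S.R g)) ≠ 0) :
    ∃ h p, g = h * p ∧ S.translate h S.Vneg0 = S.Vneg0 ∧ S.translate p S.Vpos0 = S.Vpos0 := by
  have htop : S.translate g S.Vpos0 ⊔ S.Vneg0 = ⊤ := by
    rw [eq_top_iff]
    intro v _
    obtain ⟨y, hy⟩ := ((LinearMap.isUnit_iff_isUnit_det _).2 hg.isUnit |> fun h =>
      ((Module.End.isUnit_iff _).1 h).2)
      (S.Vpos.projectionOnto S.Vneg0 S.isCompl_Vpos_Vneg0 v)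
    rw [block_apply, eq_comm, ← sub_eq_zero, ← map_sub,
      Submodule.projectionOnto_apply_eq_zero_iff] at hy
    exact Submodule.mem_sup.2 ⟨S.R g y, S.apply_mem_translate g (S.Vpos_le_Vpos0 y.2), _, hy, by simp⟩
  obtain ⟨h, h1, h2⟩ := S.exists_isFrame ⟨g, rfl⟩ ⟨S.w₀, S.translate_w₀_Vpos0.symm⟩ htop
  refine ⟨h, h⁻¹ * g, by group, h2.symm, ?_⟩
  rw [translate_mul, h1, translate_inv_translate]

/-- At a point `h p` of the big cell, `h⁻¹ γ p⁻¹` passes through 1 with velocity in 𝔤. The quotient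
becomes a fixed linear form of π₀ `(B t (v' - y t))`, and the derivative of the latter vanishes: the
Lie algebra has zero neutral block, and `y` stays in V⁺. -/
lemma hasDerivAt_quotient (φ : Module.Dual ℝ V) {v : V} (hv : v ∈ S.Vzero) {γ : ℝ → V →L[ℝ] V}
    {t₀ : ℝ} {g : G} (hγ : γ t₀ = S.R g) {Z : V →L[ℝ] V} (hZ : Z ∈ S.𝔤)
    (hd : HasDerivAt γ (Z * γ t₀) t₀)
    (hdet : ∀ᶠ t in nhds t₀, LinearMap.det (block S.isCompl_Vpos_Vneg0 (γ t)) ≠ 0) :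
    HasDerivAt (fun t => (borderedMatrix S.isCompl_Vpos_Vneg0 (φ ∘ₗ S.proj0) v (γ t)).det /
      LinearMap.det (block S.isCompl_Vpos_Vneg0 (γ t))) 0 t₀ := by
  obtain ⟨h, p, rfl, hh, hp⟩ := S.exists_eq_mul_of_det_block_ne_zero (by
    rw [← hγ]; exact hdet.self_of_nhds)
  have hpp := S.translate_Vpos_of_translate_Vpos0 hp
  have hhn := S.translate_Vneg_of_translate_Vneg0 hh
  set B : ℝ → V →L[ℝ] V := fun t => S.R h⁻¹ * γ t * S.R p⁻¹ with hBdef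
  have hB1 : B t₀ = 1 := by
    simp only [hBdef, hγ, map_mul]
    rw [← mul_assoc, S.R_inv_mul_R, one_mul, S.R_mul_R_inv]
  have hB' : HasDerivAt B (Ad S.R h⁻¹ Z) t₀ := by
    have e : Ad S.R h⁻¹ Z = S.R h⁻¹ * (Z * γ t₀) * S.R p⁻¹ := by
      rw [hγ, Ad, inv_inv, map_mul]
      simp only [mul_assoc]
      rw [S.R_mul_R_inv, mul_one]
    rw [e]
    exact (hd.const_mul _).mul_const _
  have hBγ (t : ℝ) (x : V) : γ t x = S.R h (B t (S.R p x)) := by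
    simp [hBdef]
  set v' := S.proj0 (S.R p v) with hv'
  have hv'0 : v' ∈ S.Vzero := S.proj0_mem _
  obtain ⟨y, hy0, hyd, hy⟩ := exists_differentiable_solution S.isCompl_Vpos_Vneg0 hB1 hB'
    (S.Vzero_le_Vneg0 hv'0)
  have hq : S.R p v - v' ∈ S.Vpos := S.sub_proj0_mem_Vpos (by
    rw [← hp]; exact S.apply_mem_translate p (S.Vzero_le_Vpos0 hv))
  let ψ : V →L[ℝ] ℝ := LinearMap.toContinuousLinearMap
    (φ ∘ₗ S.proj0 ∘ₗ (S.R h : V →ₗ[ℝ] V) ∘ₗ S.proj0)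
  have hψ (x : V) : ψ x = φ (S.proj0 (S.R h (S.proj0 x))) := rfl
  have hder : HasDerivAt (fun t => ψ (B t (v' - y t))) 0 t₀ := by
    have hyd' : HasDerivAt (fun t => v' - (y t : V)) (-((deriv y t₀ : S.Vpos) : V)) t₀ :=
      (S.Vpos.subtypeL.hasFDerivAt.comp_hasDerivAt t₀ hyd.hasDerivAt).const_sub v'
    have := ψ.hasFDerivAt.comp_hasDerivAt t₀ (hB'.clm_apply hyd')
    have e : ψ ((Ad S.R h⁻¹ Z) (v' - (y t₀ : V)) + B t₀ (-((deriv y t₀ : S.Vpos) : V))) = 0 := by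
      rw [hy0, hB1, map_add, hψ, hψ]
      simp only [ZeroMemClass.coe_zero, sub_zero]
      rw [S.proj0_lie_apply (S.Ad_mem h⁻¹ hZ) hv'0, one_apply_eq_self,
        S.proj0_of_mem_Vpos (neg_mem (deriv y t₀).2)]
      simp
    rw [e] at this
    exact this
  refine hder.congr_of_eventuallyEq ?_
  filter_upwards [hy, hdet] with t hyt hdt
  have hz : S.R p⁻¹ (S.R p v - v' + y t) ∈ S.Vpos := by
    rw [← S.mem_translate, hpp]
    exact add_mem hq (y t).2
  have e1 : γ t (v - S.R p⁻¹ (S.R p v - v' + y t)) = S.R h (B t (v' - y t)) := by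
    rw [hBγ]
    congr 2
    rw [map_sub, R_apply_inv_apply]
    abel
  have e2 : γ t (v - S.R p⁻¹ (S.R p v - v' + y t)) ∈ S.Vneg0 := by
    rw [e1, ← hh]
    exact S.apply_mem_translate h hyt
  rw [det_borderedMatrix S.isCompl_Vpos_Vneg0 (y := ⟨_, hz⟩) e2, mul_div_cancel_left₀ _ hdt]
  change φ (S.proj0 (γ t (v - S.R p⁻¹ (S.R p v - v' + y t)))) = _
  rw [e1, hψ]
  -- Since `h` preserves V⁻, replacing the vector by its neutral part before applying `h` does not
  -- change the neutral part of the result.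
  have hm := S.apply_mem_translate h (S.sub_proj0_mem_Vneg hyt)
  rw [hhn, map_sub] at hm
  have := S.proj0_of_mem_Vneg hm
  rw [map_sub, sub_eq_zero] at this
  rw [this]

/-- The Schur complement of the `V⁺`-block of any element of `G` is the identity. -/
lemma det_borderedMatrix_eq (φ : Module.Dual ℝ V) {v : V} (hv : v ∈ S.Vzero) (g : G) :
    (borderedMatrix S.isCompl_Vpos_Vneg0 (φ ∘ₗ S.proj0) v (S.R g)).det =
      φ v * LinearMap.det (block S.isCompl_Vpos_Vneg0 (S.R g)) := by
  set M : (V →L[ℝ] V) → ℝ := fun T =>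
    (borderedMatrix S.isCompl_Vpos_Vneg0 (φ ∘ₗ S.proj0) v T).det with hM
  set D : (V →L[ℝ] V) → ℝ := fun T => LinearMap.det (block S.isCompl_Vpos_Vneg0 T) with hD
  have hMpol : M ∈ polynomialFunctions V := det_borderedMatrix_mem_polynomialFunctions _ _ _
  have hDpol : D ∈ polynomialFunctions V := det_block_mem_polynomialFunctions _
  have hF : M - φ v • D ∈ polynomialFunctions V := sub_mem hMpol (Subalgebra.smul_mem _ hDpol _)
  have hD1 : D 1 = 1 := by simp [hD, block_one]
  have hM1 : M 1 = φ v := by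
    have h0 : (1 : V →L[ℝ] V) (v - ((0 : S.Vpos) : V)) = v := by simp
    simp only [hM]
    rw [det_borderedMatrix S.isCompl_Vpos_Vneg0 (y := 0) (by rw [h0]; exact S.Vzero_le_Vneg0 hv),
      h0, block_one, map_one, one_mul]
    simp [S.proj0_of_mem_Vzero hv]
  suffices h : (M - φ v • D) (S.R g) = 0 by
    simpa [sub_eq_zero] using h
  refine S.zariskiConnected _ hF (fun g hg => ?_) g
  obtain ⟨γ, hγ, h0, h1, hd⟩ := S.exists_analytic_path hg
  have han : AnalyticOnNhd ℝ (fun t => (M - φ v • D) (γ t)) Set.univ :=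
    (analyticOnNhd_of_mem_polynomialFunctions hF).comp hγ fun _ _ => Set.mem_univ _
  have hcont : Continuous fun t => D (γ t) :=
    continuousOn_univ.1 ((analyticOnNhd_of_mem_polynomialFunctions hDpol).comp hγ
      fun _ _ => Set.mem_univ _).continuousOn
  have hne : {t | D (γ t) ≠ 0} ∈ nhds (0 : ℝ) :=
    (isOpen_ne.preimage hcont).mem_nhds (by
      change D (γ 0) ≠ 0
      rw [h0, hD1]
      exact one_ne_zero)
  obtain ⟨ε, hε, hball⟩ := Metric.mem_nhds_iff.1 hne
  have hder (t : ℝ) (ht : t ∈ Metric.ball (0 : ℝ) ε) :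
      HasDerivAt (fun t => M (γ t) / D (γ t)) 0 t := by
    obtain ⟨⟨k, hk⟩, Z, hZ, hdZ⟩ := hd t
    refine S.hasDerivAt_quotient φ hv hk.symm hZ hdZ ?_
    filter_upwards [Metric.isOpen_ball.mem_nhds ht] with s hs using hball hs
  have hconst (t : ℝ) (ht : t ∈ Metric.ball (0 : ℝ) ε) : M (γ t) / D (γ t) = φ v := by
    have := Metric.isOpen_ball.is_const_of_deriv_eq_zero (convex_ball (0 : ℝ) ε).isPreconnected
      (fun t ht => (hder t ht).differentiableAt.differentiableWithinAt)
      (fun t ht => (hder t ht).deriv) ht (Metric.mem_ball_self hε)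
    rw [this, h0, hM1, hD1, div_one]
  -- The quotient is constant only where the denominator is known to be nonzero. After clearing the
  -- denominator, the identity theorem extends the equality to the whole path, including its
  -- endpoint.
  have hzero : (fun t => (M - φ v • D) (γ t)) = fun _ => 0 := by
    refine han.eq_of_eventuallyEq analyticOnNhd_const (z₀ := 0) ?_
    filter_upwards [Metric.ball_mem_nhds (0 : ℝ) hε] with t ht
    have := hconst t ht
    rw [div_eq_iff (hball ht)] at this
    simp [this]
  rw [← h1]
  exact congrFun hzero 1

/-- The stabilizer of `V^{+,0}` acts trivially on `V^{+,0} / V⁺`. -/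
lemma proj0_R_of_mem_Vzero {p : G} (hp : S.translate p S.Vpos0 = S.Vpos0) {v : V}
    (hv : v ∈ S.Vzero) : S.proj0 (S.R p v) = v := by
  have hpp := S.translate_Vpos_of_translate_Vpos0 hp
  -- `p` is injective and preserves V⁺, so its V⁺-block is invertible.
  have hdet : LinearMap.det (block S.isCompl_Vpos_Vneg0 (S.R p)) ≠ 0 := by
    refine ((LinearMap.isUnit_iff_isUnit_det _).1 ?_).ne_zero
    rw [LinearMap.isUnit_iff_ker_eq_bot, eq_bot_iff]
    intro y hy
    rw [LinearMap.mem_ker, block_apply, Submodule.projectionOnto_apply_eq_zero_iff] at hy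
    have hy' : S.R p y ∈ S.Vpos := hpp.le (S.apply_mem_translate p y.2)
    have h0 := S.isCompl_Vpos_Vneg0.disjoint.le_bot ⟨hy', hy⟩
    rw [Submodule.mem_bot] at h0 ⊢
    exact Subtype.ext (S.R_injective p (by simpa using h0))
  have hq : S.R p v - S.proj0 (S.R p v) ∈ S.Vpos := S.sub_proj0_mem_Vpos (by
    rw [← hp]; exact S.apply_mem_translate p (S.Vzero_le_Vpos0 hv))
  have hz : S.R p⁻¹ (S.R p v - S.proj0 (S.R p v)) ∈ S.Vpos := by
    rw [← S.mem_translate, hpp]; exact hq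
  have e : S.R p (v - S.R p⁻¹ (S.R p v - S.proj0 (S.R p v))) = S.proj0 (S.R p v) := by
    rw [map_sub, R_apply_inv_apply]; abel
  refine (Module.forall_dual_apply_eq_zero_iff ℝ _).1 (fun φ => ?_) |> sub_eq_zero.1
  have h1 := S.det_borderedMatrix_eq φ hv p
  rw [det_borderedMatrix S.isCompl_Vpos_Vneg0 (y := ⟨_, hz⟩) (by
    rw [e]; exact S.Vzero_le_Vneg0 (S.proj0_mem _)), e, mul_comm] at h1
  have h2 := mul_right_cancel₀ hdet h1
  rw [LinearMap.comp_apply, S.proj0_of_mem_Vzero (S.proj0_mem _)] at h2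
  rw [map_sub, h2, sub_self]

/-- The stabilizer of `V^{+,0}` acts trivially on `V^{+,0} / V⁺`. -/
lemma proj0_R_of_mem_Vpos0 {p : G} (hp : S.translate p S.Vpos0 = S.Vpos0) {v : V}
    (hv : v ∈ S.Vpos0) : S.proj0 (S.R p v) = S.proj0 v := by
  have h := S.apply_mem_translate p (S.sub_proj0_mem_Vpos hv)
  rw [S.translate_Vpos_of_translate_Vpos0 hp, map_sub] at h
  have h2 := S.proj0_of_mem_Vpos h
  rw [map_sub, sub_eq_zero] at h2
  rw [h2, S.proj0_R_of_mem_Vzero hp (S.proj0_mem v)]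

/-- The common stabilizer of `V^{+,0}` and `V^{-,0}` preserves `π₀`. -/
lemma proj0_R {p : G} (hp : S.translate p S.Vpos0 = S.Vpos0)
    (hn : S.translate p S.Vneg0 = S.Vneg0) (v : V) : S.proj0 (S.R p v) = S.proj0 v := by
  obtain ⟨x, hx, y, hy, rfl⟩ := Submodule.mem_sup.1
    (S.isCompl_Vzero.sup_eq_top ▸ Submodule.mem_top : v ∈ S.Vzero ⊔ (S.Vpos ⊔ S.Vneg))
  obtain ⟨a, ha, b, hb, rfl⟩ := Submodule.mem_sup.1 hy
  have ha' := S.apply_mem_translate p ha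
  have hb' := S.apply_mem_translate p hb
  rw [S.translate_Vpos_of_translate_Vpos0 hp] at ha'
  rw [S.translate_Vneg_of_translate_Vneg0 hn] at hb'
  simp only [map_add]
  rw [S.proj0_of_mem_Vpos ha, S.proj0_of_mem_Vneg hb, S.proj0_of_mem_Vpos ha',
    S.proj0_of_mem_Vneg hb', S.proj0_R_of_mem_Vzero hp hx, S.proj0_of_mem_Vzero hx]

end NonSwingingRep

namespace NonSwingingRep

variable (S : NonSwingingRep G V) [FiniteDimensional ℝ V] [CompleteSpace V]

/-! ### The co-neutral maps -/

section CoNeutral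

variable {S} {W₁ W₂ W₃ : Submodule ℝ V}

/-- Two frames of one pair differ by an element that stabilizes both V^{+,0} and V^{-,0}, and such
an element does not change π₀. -/
lemma coNeutral_eq {h : G} (hh : S.IsFrame h W₁ W₂) :
    S.coNeutral W₁ W₂ = S.proj0 ∘ₗ (S.R h⁻¹ : V →ₗ[ℝ] V) := by
  have hex : ∃ h : G, S.IsFrame h W₁ W₂ := ⟨h, hh⟩
  rw [coNeutral, dif_pos hex]
  obtain ⟨h1, h2⟩ := hh
  obtain ⟨k1, k2⟩ := hex.choose_spec
  set k := hex.choose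
  ext v
  change S.proj0 (S.R k⁻¹ v) = S.proj0 (S.R h⁻¹ v)
  rw [← S.proj0_R (p := k⁻¹ * h) _ _ (S.R h⁻¹ v), R_mul_apply, R_apply_inv_apply]
  · rw [translate_mul, ← h1, k1, translate_inv_translate]
  · rw [translate_mul, ← h2, k2, translate_inv_translate]

lemma coNeutral_apply {h : G} (hh : S.IsFrame h W₁ W₂) (v : V) :
    S.coNeutral W₁ W₂ v = S.proj0 (S.R h⁻¹ v) := by
  rw [coNeutral_eq hh]; rfl

/-- The frames share their first space, so `h⁻¹ k` stabilizes V^{+,0} and acts trivially modulo V⁺.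
-/
lemma coNeutral_left {h k : G} (hh : S.IsFrame h W₁ W₂) (hk : S.IsFrame k W₁ W₃) {v : V}
    (hv : v ∈ W₁) : S.coNeutral W₁ W₂ v = S.coNeutral W₁ W₃ v := by
  rw [coNeutral_apply hh, coNeutral_apply hk,
    ← S.proj0_R_of_mem_Vpos0 (p := h⁻¹ * k) _ (v := S.R k⁻¹ v), R_mul_apply, R_apply_inv_apply]
  · rwa [← S.mem_translate, ← hk.1]
  · rw [translate_mul, ← hk.1, hh.1, translate_inv_translate]

lemma isFrame_swap {h : G} (hh : S.IsFrame h W₁ W₂) : S.IsFrame (h * S.w₀) W₂ W₁ :=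
  ⟨by rw [translate_mul, translate_w₀_Vpos0, hh.2],
    by rw [translate_mul, translate_w₀_Vneg0, hh.1]⟩

lemma proj0_R_w₀ (v : V) : S.proj0 (S.R S.w₀ v) = S.R S.w₀ (S.proj0 v) := by
  obtain ⟨x, hx, y, hy, rfl⟩ := Submodule.mem_sup.1
    (S.isCompl_Vzero.sup_eq_top ▸ Submodule.mem_top : v ∈ S.Vzero ⊔ (S.Vpos ⊔ S.Vneg))
  have hx' := S.apply_mem_translate S.w₀ hx
  have hy' := S.apply_mem_translate S.w₀ hy
  rw [translate_w₀_Vzero] at hx'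
  rw [translate_sup, translate_w₀_Vpos, translate_w₀_Vneg, sup_comm] at hy'
  simp only [map_add]
  rw [S.proj0_of_mem_Vzero hx, S.proj0_of_mem_Vzero hx', S.proj0_eq_zero hy, S.proj0_eq_zero hy',
    map_zero]

/-- If `h` is a frame of a pair, `h w₀` is one of the swapped pair, and π₀ commutes with `w₀`. -/
lemma coNeutral_swap {h : G} (hh : S.IsFrame h W₁ W₂) (v : V) :
    S.R S.w₀ (S.coNeutral W₂ W₁ v) = S.coNeutral W₁ W₂ v := by
  rw [coNeutral_apply hh, coNeutral_apply (isFrame_swap hh), mul_inv_rev, R_mul_apply,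
    ← proj0_R_w₀, R_apply_inv_apply]

lemma coNeutral_right {h k : G} (hh : S.IsFrame h W₂ W₁) (hk : S.IsFrame k W₃ W₁) {v : V}
    (hv : v ∈ W₁) : S.coNeutral W₂ W₁ v = S.coNeutral W₃ W₁ v := by
  rw [← coNeutral_swap hh, ← coNeutral_swap hk,
    coNeutral_left (isFrame_swap hh) (isFrame_swap hk) hv]

lemma isFrame_translate (g : G) {h : G} (hh : S.IsFrame h W₁ W₂) :
    S.IsFrame (g * h) (S.translate g W₁) (S.translate g W₂) :=
  ⟨by rw [translate_mul, hh.1], by rw [translate_mul, hh.2]⟩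

lemma coNeutral_translate (g : G) {h : G} (hh : S.IsFrame h W₁ W₂) (v : V) :
    S.coNeutral (S.translate g W₁) (S.translate g W₂) (S.R g v) = S.coNeutral W₁ W₂ v := by
  rw [coNeutral_apply hh, coNeutral_apply (isFrame_translate g hh), mul_inv_rev, R_mul_apply,
    R_inv_apply_apply]

end CoNeutral

/-! ### Families of mutually transverse affine parabolic spaces -/

/-- The affine spaces `A i` are mutually transverse affine parabolic spaces. -/
structure IsTransverseFamily {ι : Type*} (A : ι → AffineSubspace ℝ V) : Prop where
  isAffineParabolic : ∀ i, S.IsAffineParabolic (A i)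
  sup_eq_top : ∀ i j, i ≠ j → (A i).direction ⊔ (A j).direction = ⊤

namespace IsTransverseFamily

variable {S} {ι : Type*} {A : ι → AffineSubspace ℝ V}
variable {i j k l : ι}

lemma exists_isFrame (hA : S.IsTransverseFamily A) (h : i ≠ j) :
    ∃ g, S.IsFrame g (A i).direction (A j).direction :=
  S.exists_isFrame (hA.isAffineParabolic i).2 (hA.isAffineParabolic j).2 (hA.sup_eq_top i j h)

lemma exists_mem_inter (hA : S.IsTransverseFamily A) (h : i ≠ j) : ∃ x, x ∈ A i ∧ x ∈ A j :=
  AffineSubspace.inter_nonempty_of_nonempty_of_sup_direction_eq_top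
    (hA.isAffineParabolic i).1 (hA.isAffineParabolic j).1 (hA.sup_eq_top i j h)

lemma nuStar_left (hA : S.IsTransverseFamily A) (hij : i ≠ j) (hik : i ≠ k) {x y : V}
    (hx : x ∈ A i) (hy : y ∈ A i) :
    S.nuStar (A i) (A j) x - S.nuStar (A i) (A j) y
      = S.nuStar (A i) (A k) x - S.nuStar (A i) (A k) y := by
  obtain ⟨g, hg⟩ := hA.exists_isFrame hij
  obtain ⟨h, hh⟩ := hA.exists_isFrame hik
  rw [← map_sub, ← map_sub]
  exact coNeutral_left hg hh (AffineSubspace.vsub_mem_direction hx hy)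

lemma nuStar_right (hA : S.IsTransverseFamily A) (hij : j ≠ i) (hik : k ≠ i) {x y : V}
    (hx : x ∈ A i) (hy : y ∈ A i) :
    S.nuStar (A j) (A i) x - S.nuStar (A j) (A i) y
      = S.nuStar (A k) (A i) x - S.nuStar (A k) (A i) y := by
  obtain ⟨g, hg⟩ := hA.exists_isFrame hij
  obtain ⟨h, hh⟩ := hA.exists_isFrame hik
  rw [← map_sub, ← map_sub]
  exact coNeutral_right hg hh (AffineSubspace.vsub_mem_direction hx hy)

lemma R_w₀_nuStar (hA : S.IsTransverseFamily A) (hij : i ≠ j) (v : V) :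
    S.R S.w₀ (S.nuStar (A j) (A i) v) = S.nuStar (A i) (A j) v := by
  obtain ⟨g, hg⟩ := hA.exists_isFrame hij
  exact coNeutral_swap hg v

/-- Moving the point of `A i ∩ A k` changes both terms by the same amount, as both agree with
ν*_{i,k} on such differences; for the point of `A j ∩ A l` the comparison is with ν*_{j,l}. -/
lemma isCrossRatioValue_unique (hA : S.IsTransverseFamily A) (hik : i ≠ k) (hil : i ≠ l)
    (hjk : j ≠ k) (hjl : j ≠ l) {b c : V}
    (hb : S.IsCrossRatioValue (A i) (A j) (A k) (A l) b)
    (hc : S.IsCrossRatioValue (A i) (A j) (A k) (A l) c) : b = c := by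
  obtain ⟨x, y, hxi, hxk, hyj, hyl, rfl⟩ := hb
  obtain ⟨x', y', hxi', hxk', hyj', hyl', rfl⟩ := hc
  have h1 := hA.nuStar_left hil hik hxi hxi'
  have h2 := hA.nuStar_right hik hjk hxk hxk'
  have h3 := hA.nuStar_left hjl hjk hyj hyj'
  have h4 := hA.nuStar_right hil hjl hyl hyl'
  simp only [LinearMap.sub_apply, map_sub]
  linear_combination (norm := module) h1 + h2 - h3 - h4

lemma crossRatio_eq (hA : S.IsTransverseFamily A) (hik : i ≠ k) (hil : i ≠ l)
    (hjk : j ≠ k) (hjl : j ≠ l) {x y : V}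
    (hxi : x ∈ A i) (hxk : x ∈ A k) (hyj : y ∈ A j) (hyl : y ∈ A l) :
    S.crossRatio (A i) (A j) (A k) (A l)
      = S.nuStar (A i) (A l) x - S.nuStar (A i) (A l) y
        - (S.nuStar (A j) (A k) x - S.nuStar (A j) (A k) y) := by
  have hv : S.IsCrossRatioValue (A i) (A j) (A k) (A l)
      ((S.nuStar (A i) (A l) - S.nuStar (A j) (A k)) (x - y)) :=
    ⟨x, y, hxi, hxk, hyj, hyl, rfl⟩
  have hex : ∃ b, S.IsCrossRatioValue (A i) (A j) (A k) (A l) b := ⟨_, hv⟩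
  rw [crossRatio, dif_pos hex,
    hA.isCrossRatioValue_unique hik hil hjk hjl hex.choose_spec hv]
  simp only [LinearMap.sub_apply, map_sub]
  abel

/-- Each point occurs twice with opposite signs, under maps that agree on the direction in which it
moves. -/
lemma isTripleRatioValue_unique (hA : S.IsTransverseFamily A) (hij : i ≠ j) (hjk : j ≠ k)
    (hki : k ≠ i) {b c : V} (hb : S.IsTripleRatioValue (A i) (A j) (A k) b)
    (hc : S.IsTripleRatioValue (A i) (A j) (A k) c) : b = c := by
  obtain ⟨x, y, z, hx, hy, hz, rfl⟩ := hb
  obtain ⟨x', y', z', hx', hy', hz', rfl⟩ := hc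
  have h1 := hA.nuStar_left hij hki.symm hx hx'
  have h2 := hA.nuStar_right hij.symm hki hx hx'
  have h3 := hA.nuStar_left hjk hij.symm hy hy'
  have h4 := hA.nuStar_right hjk.symm hij hy hy'
  have h5 := hA.nuStar_left hki hjk.symm hz hz'
  have h6 := hA.nuStar_right hki.symm hjk hz hz'
  simp only [LinearMap.add_apply, map_sub]
  linear_combination (norm := module) h1 + h2 + h3 + h4 + h5 + h6

lemma tripleRatio_eq (hA : S.IsTransverseFamily A) (hij : i ≠ j) (hjk : j ≠ k)
    (hki : k ≠ i) {x y z : V} (hx : x ∈ A i) (hy : y ∈ A j) (hz : z ∈ A k) :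
    S.tripleRatio (A i) (A j) (A k)
      = (S.nuStar (A i) (A j) + S.nuStar (A j) (A i)) (x - y)
        + (S.nuStar (A j) (A k) + S.nuStar (A k) (A j)) (y - z)
        + (S.nuStar (A k) (A i) + S.nuStar (A i) (A k)) (z - x) := by
  have hv : S.IsTripleRatioValue (A i) (A j) (A k) _ := ⟨x, y, z, hx, hy, hz, rfl⟩
  have hex : ∃ b, S.IsTripleRatioValue (A i) (A j) (A k) b := ⟨_, hv⟩
  rw [tripleRatio, dif_pos hex, hA.isTripleRatioValue_unique hij hjk hki hex.choose_spec hv]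

lemma act_direction (g : G) (Y : V) (B : AffineSubspace ℝ V) :
    (B.map (S.act g Y)).direction = S.translate g B.direction := by
  rw [AffineSubspace.map_direction, translate]
  congr 1
  simp [act]

lemma act_apply (g : G) (Y x : V) : S.act g Y x = S.R g x + Y := by
  simp [act]

lemma map_act (hA : S.IsTransverseFamily A) (g : G) (Y : V) :
    S.IsTransverseFamily fun i => (A i).map (S.act g Y) where
  isAffineParabolic i := by
    obtain ⟨⟨x, hx⟩, h, hh⟩ := hA.isAffineParabolic i
    refine ⟨⟨S.act g Y x, AffineSubspace.mem_map_of_mem _ hx⟩, g * h, ?_⟩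
    rw [act_direction, hh, translate_mul]
  sup_eq_top i j h := by
    rw [act_direction, act_direction, ← translate_sup, hA.sup_eq_top i j h, translate_top]

lemma nuStar_map_act (hA : S.IsTransverseFamily A) (h : i ≠ j) (g : G) (Y v : V) :
    S.nuStar ((A i).map (S.act g Y)) ((A j).map (S.act g Y)) (S.R g v)
      = S.nuStar (A i) (A j) v := by
  obtain ⟨k, hk⟩ := hA.exists_isFrame h
  rw [nuStar, act_direction, act_direction]
  exact coNeutral_translate g hk v

lemma crossRatio_map_act (hA : S.IsTransverseFamily A) (hik : i ≠ k) (hil : i ≠ l)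
    (hjk : j ≠ k) (hjl : j ≠ l) (g : G) (Y : V) :
    S.crossRatio ((A i).map (S.act g Y)) ((A j).map (S.act g Y)) ((A k).map (S.act g Y))
      ((A l).map (S.act g Y)) = S.crossRatio (A i) (A j) (A k) (A l) := by
  obtain ⟨x, hxi, hxk⟩ := hA.exists_mem_inter hik
  obtain ⟨y, hyj, hyl⟩ := hA.exists_mem_inter hjl
  have hm {B : AffineSubspace ℝ V} {z : V} (hz : z ∈ B) :
      S.act g Y z ∈ B.map (S.act g Y) := AffineSubspace.mem_map_of_mem _ hz
  rw [hA.crossRatio_eq hik hil hjk hjl hxi hxk hyj hyl,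
    (hA.map_act g Y).crossRatio_eq hik hil hjk hjl (hm hxi) (hm hxk) (hm hyj) (hm hyl)]
  simp only [act_apply, map_add, hA.nuStar_map_act hil, hA.nuStar_map_act hjk]
  abel

end IsTransverseFamily

end NonSwingingRep
end AffineInv
end

/-! ### The proposition -/

theorem proposition3p2 {G V : Type*} [Group G] [NormedAddCommGroup V] [NormedSpace ℝ V]
    [FiniteDimensional ℝ V] (hV : 1 < Module.finrank ℝ V)
    (S : AffineInv.NonSwingingRep G V)
    -- `A 0` is the space `A_*`
    (A : Fin 5 → AffineSubspace ℝ V) (hA : ∀ i, S.IsAffineParabolic (A i))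
    (htrans : ∀ i j, i ≠ j → (A i).direction ⊔ (A j).direction = ⊤) :
    S.ChoicesWellDefined A ∧
    (∀ (g : G) (Y : V),
      S.crossRatio ((A 1).map (S.act g Y)) ((A 2).map (S.act g Y))
        ((A 3).map (S.act g Y)) ((A 4).map (S.act g Y))
        = S.crossRatio (A 1) (A 2) (A 3) (A 4)) ∧
    (S.crossRatio (A 1) (A 2) (A 3) (A 4) = S.crossRatio (A 2) (A 1) (A 4) (A 3) ∧
      S.crossRatio (A 1) (A 2) (A 3) (A 4)
        = -(S.R S.w₀ (S.crossRatio (A 3) (A 4) (A 1) (A 2))) ∧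
      S.crossRatio (A 1) (A 2) (A 3) (A 4)
        = -(S.R S.w₀ (S.crossRatio (A 4) (A 3) (A 2) (A 1)))) ∧
    S.crossRatio (A 1) (A 2) (A 3) (A 4) + S.crossRatio (A 1) (A 2) (A 4) (A 3) = 0 ∧
    S.crossRatio (A 1) (A 0) (A 3) (A 4) + S.crossRatio (A 0) (A 2) (A 3) (A 4)
      = S.crossRatio (A 1) (A 2) (A 3) (A 4) ∧
    S.tripleRatio (A 2) (A 3) (A 4)
      = S.crossRatio (A 0) (A 2) (A 3) (A 4) + S.crossRatio (A 0) (A 3) (A 4) (A 2)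
        + S.crossRatio (A 0) (A 4) (A 2) (A 3) := by
  have := FiniteDimensional.complete ℝ V
  have h : S.IsTransverseFamily A := ⟨hA, htrans⟩
  have e {i j k l : Fin 5} (hd : i ≠ k ∧ i ≠ l ∧ j ≠ k ∧ j ≠ l) {x y : V}
      (hxi : x ∈ A i) (hxk : x ∈ A k) (hyj : y ∈ A j) (hyl : y ∈ A l) :=
    h.crossRatio_eq hd.1 hd.2.1 hd.2.2.1 hd.2.2.2 hxi hxk hyj hyl
  have hl {i : Fin 5} (j k : Fin 5) (hd : i ≠ j ∧ i ≠ k) {x y : V} (hx : x ∈ A i) (hy : y ∈ A i) :=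
    h.nuStar_left hd.1 hd.2 hx hy
  have hr {i : Fin 5} (j k : Fin 5) (hd : j ≠ i ∧ k ≠ i) {x y : V} (hx : x ∈ A i) (hy : y ∈ A i) :=
    h.nuStar_right hd.1 hd.2 hx hy
  have hX (i j : Fin 5) (hd : i ≠ j) : ∃ x, x ∈ A i ∧ x ∈ A j := h.exists_mem_inter hd
  obtain ⟨a, ha1, ha3⟩ := hX 1 3 (by decide)
  obtain ⟨b, hb2, hb4⟩ := hX 2 4 (by decide)
  obtain ⟨c, hc1, hc4⟩ := hX 1 4 (by decide)
  obtain ⟨d, hd2, hd3⟩ := hX 2 3 (by decide)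
  obtain ⟨r, hr4, hr3⟩ := hX 4 3 (by decide)
  obtain ⟨s₂, hs20, hs22⟩ := hX 0 2 (by decide)
  obtain ⟨s₃, hs30, hs33⟩ := hX 0 3 (by decide)
  obtain ⟨s₄, hs40, hs44⟩ := hX 0 4 (by decide)
  have e1234 := e (by decide) ha1 ha3 hb2 hb4
  refine ⟨⟨S.isCompl_Vzero, fun i j hij => h.exists_isFrame hij,
    fun i j _ g hg => AffineInv.NonSwingingRep.coNeutral_eq hg, ?_, ?_⟩, ?_, ⟨?_, ?_, ?_⟩, ?_, ?_,
    ?_⟩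
  · exact ⟨_, ⟨a, b, ha1, ha3, hb2, hb4, rfl⟩, fun y hy =>
      h.isCrossRatioValue_unique (by decide) (by decide) (by decide) (by decide) hy ⟨a, b, ha1, ha3, hb2, hb4, rfl⟩⟩
  · exact ⟨_, ⟨b, d, r, hb2, hd3, hr4, rfl⟩, fun y hy =>
      h.isTripleRatioValue_unique (by decide) (by decide) (by decide) hy
        ⟨b, d, r, hb2, hd3, hr4, rfl⟩⟩
  · exact fun g Y => h.crossRatio_map_act (by decide) (by decide) (by decide) (by decide) g Y
  · rw [e1234, e (by decide) hb2 hb4 ha1 ha3]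
    abel
  · rw [e1234, e (by decide) ha3 ha1 hb4 hb2]
    simp only [map_sub]
    -- The same two points serve on both sides; ω₀ reverses the index pairs, and the remaining
    -- difference is a sign.
    rw [h.R_w₀_nuStar (i := 2) (j := 3) (by decide), h.R_w₀_nuStar (i := 2) (j := 3) (by decide),
      h.R_w₀_nuStar (i := 1) (j := 4) (by decide), h.R_w₀_nuStar (i := 1) (j := 4) (by decide)]
    abel
  · rw [e1234, e (by decide) hb4 hb2 ha3 ha1]
    simp only [map_sub]
    rw [h.R_w₀_nuStar (i := 2) (j := 3) (by decide), h.R_w₀_nuStar (i := 2) (j := 3) (by decide),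
      h.R_w₀_nuStar (i := 1) (j := 4) (by decide), h.R_w₀_nuStar (i := 1) (j := 4) (by decide)]
    abel
  · rw [e1234, e (by decide) hc1 hc4 hd2 hd3]
    -- The two cross ratios use different intersection points; each term moves one point inside one
    -- affine space.
    linear_combination (norm := module) hl 4 3 (by decide) ha1 hc1 + hr 1 2 (by decide) ha3 hd3
      - hr 1 2 (by decide) hb4 hc4 + hl 3 4 (by decide) hb2 hd2
  · rw [e (by decide) ha1 ha3 hs40 hs44, e (by decide) hs30 hs33 hb2 hb4,
      e (by decide) ha1 ha3 hb2 hb4]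
    linear_combination (norm := module) hr 1 0 (by decide) hb4 hs44 + hr 2 0 (by decide) ha3 hs33
      + hl 3 4 (by decide) hs40 hs30
  · rw [h.tripleRatio_eq (by decide) (by decide) (by decide) hb2 hd3 hr4,
      e (by decide) hs30 hs33 hb2 hb4, e (by decide) hs40 hs44 hd3 hd2,
      e (by decide) hs20 hs22 hr4 hr3]
    simp only [LinearMap.add_apply, map_sub]
    linear_combination (norm := module) hl 2 4 (by decide) hs30 hs40 - hl 2 3 (by decide) hs30 hs20
      + hr 0 3 (by decide) hs22 hb2 - hr 0 4 (by decide) hs22 hb2 - hr 0 3 (by decide) hs22 hd2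
      - hr 0 2 (by decide) hs33 hd3 + hr 0 4 (by decide) hs33 hd3 - hr 0 4 (by decide) hs33 hr3
      - hr 0 2 (by decide) hs44 hb4 + hr 0 2 (by decide) hs44 hr4 - hr 0 3 (by decide) hs44 hr4
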